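/- Let $\Bbbk$ be a field; all categories and functors are $\Bbbk$-linear. A *semigroup category* is a category $\mathcal S$ with a $\Bbbk$-bilinear bifunctor $\boxtimes$ and a natural associativity isomorphism $\mathsf a_{X,Y,Z}\colon (X\boxtimes Y)\boxtimes Z\to X\boxtimes(Y\boxtimes Z)$ satisfying the pentagon axiom (no unit object is assumed). Let $\mathcal S$ be a small semigroup category. Write $\mathcal S\text{-Mod}(\mathcal S,\mathcal S)$ and $\text{Mod-}\mathcal S(\mathcal S,\mathcal S)$ for the categories of endofunctors of $\mathcal S$ as a left, respectively right, module category over itself (functors with a coherent natural isomorphism $\Phi(X\boxtimes Y)\cong X\boxtimes\Phi(Y)$, respectively $\Phi(X\boxtimes Y)\cong\Phi(X)\boxtimes Y$), with the natural transformations compatible with these isomorphisms as morphisms. An *adjunction* in $\mathcal S$ is a tuple $(F,F',\eta^l,\eta^r,\varepsilon^l,\varepsilon^r)$ with objects $F,F'\in\mathcal S$, left module transformations $\eta^l\colon \mathrm{Id}\to -\boxtimes(F'\boxtimes F)$, $\varepsilon^l\colon -\boxtimes(F\boxtimes F')\to\mathrm{Id}$ and right module transformations $\eta^r\colon \mathrm{Id}\to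 (F'\boxtimes F)\boxtimes -$, $\varepsilon^r\colon (F\boxtimes F')\boxtimes -\to\mathrm{Id}$ such that, up to the evident associators: 1. $(-\boxtimes F',-\boxtimes F,\eta^l,\varepsilon^l)$ is an adjunction in $\mathcal S\text{-Mod}(\mathcal S,\mathcal S)$; 2. $(F\boxtimes-,F'\boxtimes-,\eta^r,\varepsilon^r)$ is an adjunction in $\text{Mod-}\mathcal S(\mathcal S,\mathcal S)$; 3. $\varepsilon^r_F\circ\mathsf a^{-1}_{F,F',F}\circ\eta^l_F=\mathrm{id}_F$ and $\varepsilon^l_{F'}\circ\mathsf a_{F',F,F'}\circ\eta^r_{F'}=\mathrm{id}_{F'}$; 4. for all $H,K\in\mathcal S$: $\mathsf a^{-1}_{H,F'\boxtimes F,K}\circ(H\boxtimes\eta^r_K)=\eta^l_H\boxtimes K$ and $(H\boxtimes\varepsilon^r_K)\circ\mathsf a_{H,F\boxtimes F',K}=\varepsilon^l_H\boxtimes K$. Then $F'$ is called a right dual of $F$, and $F$ a left dual of $F'$; $\mathcal S$ is *rigid* if every object has both a right and a left dual. Let $[\mathcal S^{\mathrm{op}},\mathbf{Vec}_\Bbbk]$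 be the category of $\Bbbk$-linear presheaves, with Day convolution $$(P\circledast Q)(-)=\int^{H,K\in\mathcal S}\mathcal S(-,H\boxtimes K)\otimes_\Bbbk P(H)\otimes_\Bbbk Q(K)$$ and its canonical associator; it is a semigroup category. **Theorem.** Assume that $\mathcal S$ is rigid. Then $[\mathcal S^{\mathrm{op}},\mathbf{Vec}_\Bbbk]$ with Day convolution is a monoidal category whose unit object is the presheaf $$F\mapsto \mathrm{Hom}_{\text{Mod-}\mathcal S(\mathcal S,\mathcal S)}(F\boxtimes-,\mathrm{Id}),$$ that is, there are natural left and right unitors for this presheaf which satisfy the triangle axiom. Moreover, the Yoneda embedding $\mathcal S\to[\mathcal S^{\mathrm{op}},\mathbf{Vec}_\Bbbk]$, $F\mapsto\mathcal S(-,F)$, is full, faithful and a semigroup functor, by means of isomorphisms $\mathcal S(-,H)\circledast\mathcal S(-,K)\cong\mathcal S(-,H\boxtimes K)$ which send the class of $f\otimes a\otimes b$ (for $f\colon X\to A\boxtimes B$, $a\colon A\to H$, $b\colon B\to K$) to $(a\boxtimes b)\circ f$; and every $\mathcal S(-,F)$ is a rigid object of this monoidal category, i.e. has both a left and a right dual.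 -/

import Mathlib

open CategoryTheory Opposite TensorProduct

universe w v u v₁ u₁ v₂ u₂

namespace NonunitalRigidity

/-! ### Semigroup categories -/

/-- A semigroup category: a category with a tensor product bifunctor (given by its left and right
whiskerings) and an associator that is natural in the three variables and satisfies the pentagon
axiom; no unit object is required. -/
class SemigroupCategory (C : Type u) [Category.{v} C] where
  tensorObj : C → C → C
  whiskerLeft (X : C) {Y₁ Y₂ : C} (f : Y₁ ⟶ Y₂) : tensorObj X Y₁ ⟶ tensorObj X Y₂
  whiskerRight {X₁ X₂ : C} (f : X₁ ⟶ X₂) (Y : C) : tensorObj X₁ Y ⟶ tensorObj X₂ Y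
  associator (X Y Z : C) : tensorObj (tensorObj X Y) Z ≅ tensorObj X (tensorObj Y Z)
  whiskerLeft_id (X Y : C) : whiskerLeft X (𝟙 Y) = 𝟙 (tensorObj X Y)
  whiskerLeft_comp (X : C) {Y₁ Y₂ Y₃ : C} (f : Y₁ ⟶ Y₂) (g : Y₂ ⟶ Y₃) :
    whiskerLeft X (f ≫ g) = whiskerLeft X f ≫ whiskerLeft X g
  id_whiskerRight (X Y : C) : whiskerRight (𝟙 X) Y = 𝟙 (tensorObj X Y)
  comp_whiskerRight {X₁ X₂ X₃ : C} (f : X₁ ⟶ X₂) (g : X₂ ⟶ X₃) (Y : C) :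
    whiskerRight (f ≫ g) Y = whiskerRight f Y ≫ whiskerRight g Y
  whisker_exchange {X₁ X₂ Y₁ Y₂ : C} (f : X₁ ⟶ X₂) (g : Y₁ ⟶ Y₂) :
    whiskerLeft X₁ g ≫ whiskerRight f Y₂ = whiskerRight f Y₁ ≫ whiskerLeft X₂ g
  associator_naturality_left {X₁ X₂ : C} (f : X₁ ⟶ X₂) (Y Z : C) :
    whiskerRight (whiskerRight f Y) Z ≫ (associator X₂ Y Z).hom =
      (associator X₁ Y Z).hom ≫ whiskerRight f (tensorObj Y Z)
  associator_naturality_middle (X : C) {Y₁ Y₂ : C} (f : Y₁ ⟶ Y₂) (Z : C) :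
    whiskerRight (whiskerLeft X f) Z ≫ (associator X Y₂ Z).hom =
      (associator X Y₁ Z).hom ≫ whiskerLeft X (whiskerRight f Z)
  associator_naturality_right (X Y : C) {Z₁ Z₂ : C} (f : Z₁ ⟶ Z₂) :
    whiskerLeft (tensorObj X Y) f ≫ (associator X Y Z₂).hom =
      (associator X Y Z₁).hom ≫ whiskerLeft X (whiskerLeft Y f)
  pentagon (W X Y Z : C) :
    whiskerRight (associator W X Y).hom Z ≫ (associator W (tensorObj X Y) Z).hom ≫
        whiskerLeft W (associator X Y Z).hom =
      (associator (tensorObj W X) Y Z).hom ≫ (associator W X (tensorObj Y Z)).hom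

infixr:70 " ⊠ " => SemigroupCategory.tensorObj
infixr:81 " ◁ₛ " => SemigroupCategory.whiskerLeft
infixl:81 " ▷ₛ " => SemigroupCategory.whiskerRight
notation "αₛ" => SemigroupCategory.associator

/-- A semigroup structure on a `k`-linear category is `k`-linear if its tensor product is
`k`-bilinear on morphisms, that is, comes from a `k`-linear functor `C ⊗ₖ C ⥤ C`. -/
class LinearSemigroupCategory (k : Type w) [Field k] (C : Type u) [Category.{v} C]
    [Preadditive C] [Linear k C] [SemigroupCategory C] : Prop where
  whiskerLeft_add (X : C) {Y₁ Y₂ : C} (f g : Y₁ ⟶ Y₂) : X ◁ₛ (f + g) = X ◁ₛ f + X ◁ₛ g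
  whiskerLeft_smul (X : C) {Y₁ Y₂ : C} (r : k) (f : Y₁ ⟶ Y₂) : X ◁ₛ (r • f) = r • X ◁ₛ f
  add_whiskerRight {X₁ X₂ : C} (f g : X₁ ⟶ X₂) (Y : C) : (f + g) ▷ₛ Y = f ▷ₛ Y + g ▷ₛ Y
  smul_whiskerRight {X₁ X₂ : C} (r : k) (f : X₁ ⟶ X₂) (Y : C) : (r • f) ▷ₛ Y = r • f ▷ₛ Y

attribute [simp] SemigroupCategory.whiskerLeft_id SemigroupCategory.id_whiskerRight

section SemigroupFunctors

variable {C : Type u₁} [Category.{v₁} C] [SemigroupCategory C]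
  {D : Type u₂} [Category.{v₂} D] [SemigroupCategory D]

/-- The structure of a (strong) semigroup functor on a functor `F` between semigroup
categories. -/
structure SemigroupFunctorStructure (F : C ⥤ D) where
  μ (X Y : C) : F.obj X ⊠ F.obj Y ≅ F.obj (X ⊠ Y)
  μ_natural_left {X₁ X₂ : C} (f : X₁ ⟶ X₂) (Y : C) :
    F.map f ▷ₛ F.obj Y ≫ (μ X₂ Y).hom = (μ X₁ Y).hom ≫ F.map (f ▷ₛ Y)
  μ_natural_right (X : C) {Y₁ Y₂ : C} (f : Y₁ ⟶ Y₂) :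
    F.obj X ◁ₛ F.map f ≫ (μ X Y₂).hom = (μ X Y₁).hom ≫ F.map (X ◁ₛ f)
  associativity (X Y Z : C) :
    (μ X Y).hom ▷ₛ F.obj Z ≫ (μ (X ⊠ Y) Z).hom ≫ F.map (αₛ X Y Z).hom =
      (αₛ (F.obj X) (F.obj Y) (F.obj Z)).hom ≫ F.obj X ◁ₛ (μ Y Z).hom ≫ (μ X (Y ⊠ Z)).hom

/-- The data which make an object `I` of a semigroup category a unit object: natural left and
right unitors satisfying the triangle axiom. -/
structure UnitStructure (I : C) where
  leftUnitor (X : C) : I ⊠ X ≅ X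
  rightUnitor (X : C) : X ⊠ I ≅ X
  leftUnitor_naturality {X Y : C} (f : X ⟶ Y) :
    I ◁ₛ f ≫ (leftUnitor Y).hom = (leftUnitor X).hom ≫ f
  rightUnitor_naturality {X Y : C} (f : X ⟶ Y) :
    f ▷ₛ I ≫ (rightUnitor Y).hom = (rightUnitor X).hom ≫ f
  triangle (X Y : C) :
    (αₛ X I Y).hom ≫ X ◁ₛ (leftUnitor Y).hom = (rightUnitor X).hom ▷ₛ Y

/-- A semigroup category together with a unit object is a monoidal category, with the same tensor
product and associator. -/
@[reducible]
def UnitStructure.toMonoidalCategory {I : C} (t : UnitStructure I) : MonoidalCategory C where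
  tensorObj := SemigroupCategory.tensorObj
  whiskerLeft := SemigroupCategory.whiskerLeft
  whiskerRight := SemigroupCategory.whiskerRight
  tensorUnit := I
  associator := SemigroupCategory.associator
  leftUnitor := t.leftUnitor
  rightUnitor := t.rightUnitor
  tensorHom_def _ _ := rfl
  id_tensorHom_id X Y := by simp
  tensorHom_comp_tensorHom {X₁ Y₁ Z₁ X₂ Y₂ Z₂} f₁ f₂ g₁ g₂ := by
    simp only [SemigroupCategory.comp_whiskerRight, SemigroupCategory.whiskerLeft_comp,
      Category.assoc]
    rw [← Category.assoc (Y₁ ◁ₛ f₂), SemigroupCategory.whisker_exchange, Category.assoc]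
  whiskerLeft_id := SemigroupCategory.whiskerLeft_id
  id_whiskerRight := SemigroupCategory.id_whiskerRight
  associator_naturality f₁ f₂ f₃ := by
    simp only [SemigroupCategory.comp_whiskerRight, SemigroupCategory.whiskerLeft_comp,
      Category.assoc, SemigroupCategory.associator_naturality_right]
    rw [← Category.assoc (_ ▷ₛ _) (αₛ _ _ _).hom, SemigroupCategory.associator_naturality_middle]
    simp only [Category.assoc]
    rw [← Category.assoc (_ ▷ₛ _) (αₛ _ _ _).hom, SemigroupCategory.associator_naturality_left]
    simp only [Category.assoc]
  leftUnitor_naturality := t.leftUnitor_naturality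
  rightUnitor_naturality := t.rightUnitor_naturality
  pentagon := SemigroupCategory.pentagon
  triangle := t.triangle

/-- An object of a monoidal category is rigid if it has both a left and a right dual; here the
monoidal structure is the one given by a unit object of a semigroup category. -/
def UnitStructure.IsRigidObject {I : C} (t : UnitStructure I) (X : C) : Prop :=
  letI : MonoidalCategory C := t.toMonoidalCategory
  Nonempty (HasLeftDual X) ∧ Nonempty (HasRightDual X)

end SemigroupFunctors

/-! ### Endofunctors of a semigroup category as a module category over itself -/

section Modules

variable (k : Type w) [Field k] (S : Type u) [Category.{v} S] [Preadditive S] [Linear k S]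
  [SemigroupCategory S]

/-- An endofunctor of `S`, regarded as a right `S`-module category. -/
structure RightModuleEndofunctor where
  functor : S ⥤ S
  additive : functor.Additive
  linear : functor.Linear k
  str (X Y : S) : functor.obj (X ⊠ Y) ≅ functor.obj X ⊠ Y
  str_natural_left {X₁ X₂ : S} (f : X₁ ⟶ X₂) (Y : S) :
    functor.map (f ▷ₛ Y) ≫ (str X₂ Y).hom = (str X₁ Y).hom ≫ functor.map f ▷ₛ Y
  str_natural_right (X : S) {Y₁ Y₂ : S} (f : Y₁ ⟶ Y₂) :
    functor.map (X ◁ₛ f) ≫ (str X Y₂).hom = (str X Y₁).hom ≫ functor.obj X ◁ₛ f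
  str_assoc (X Y Z : S) :
    functor.map (αₛ X Y Z).hom ≫ (str X (Y ⊠ Z)).hom =
      (str (X ⊠ Y) Z).hom ≫ (str X Y).hom ▷ₛ Z ≫ (αₛ (functor.obj X) Y Z).hom

/-- An endofunctor of `S`, regarded as a left `S`-module category. -/
structure LeftModuleEndofunctor where
  functor : S ⥤ S
  additive : functor.Additive
  linear : functor.Linear k
  str (X Y : S) : functor.obj (X ⊠ Y) ≅ X ⊠ functor.obj Y
  str_natural_left {X₁ X₂ : S} (f : X₁ ⟶ X₂) (Y : S) :
    functor.map (f ▷ₛ Y) ≫ (str X₂ Y).hom = (str X₁ Y).hom ≫ f ▷ₛ functor.obj Y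
  str_natural_right (X : S) {Y₁ Y₂ : S} (f : Y₁ ⟶ Y₂) :
    functor.map (X ◁ₛ f) ≫ (str X Y₂).hom = (str X Y₁).hom ≫ X ◁ₛ functor.map f
  str_assoc (X Y Z : S) :
    functor.map (αₛ X Y Z).hom ≫ (str X (Y ⊠ Z)).hom ≫ X ◁ₛ (str Y Z).hom =
      (str (X ⊠ Y) Z).hom ≫ (αₛ X Y (functor.obj Z)).hom

variable {k S} [LinearSemigroupCategory k S]

/-- The space of right `S`-module transformations, inside the space of natural transformations. -/
def rightModuleTransformations (Φ Ψ : RightModuleEndofunctor k S) :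
    Submodule k (Φ.functor ⟶ Ψ.functor) where
  carrier := {τ | ∀ X Y : S,
    (Φ.str X Y).hom ≫ τ.app X ▷ₛ Y = τ.app (X ⊠ Y) ≫ (Ψ.str X Y).hom}
  add_mem' {a b} ha hb X Y := by
    simp [LinearSemigroupCategory.add_whiskerRight k, ha X Y, hb X Y]
  zero_mem' X Y := by
    have h := LinearSemigroupCategory.smul_whiskerRight (0 : k)
      (0 : Φ.functor.obj X ⟶ Ψ.functor.obj X) Y
    simp only [zero_smul] at h
    simp [h]
  smul_mem' r a ha X Y := by
    simp [LinearSemigroupCategory.smul_whiskerRight, ha X Y]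

/-- The space of left `S`-module transformations, inside the space of natural transformations. -/
def leftModuleTransformations (Φ Ψ : LeftModuleEndofunctor k S) :
    Submodule k (Φ.functor ⟶ Ψ.functor) where
  carrier := {τ | ∀ X Y : S,
    (Φ.str X Y).hom ≫ X ◁ₛ τ.app Y = τ.app (X ⊠ Y) ≫ (Ψ.str X Y).hom}
  add_mem' {a b} ha hb X Y := by
    simp [LinearSemigroupCategory.whiskerLeft_add k, ha X Y, hb X Y]
  zero_mem' X Y := by
    have h := LinearSemigroupCategory.whiskerLeft_smul X (0 : k)
      (0 : Φ.functor.obj Y ⟶ Ψ.functor.obj Y)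
    simp only [zero_smul] at h
    simp [h]
  smul_mem' r a ha X Y := by
    simp [LinearSemigroupCategory.whiskerLeft_smul, ha X Y]

/-- The category `Mod-S(S,S)` of right `S`-module endofunctors of `S`. -/
instance : Category (RightModuleEndofunctor k S) where
  Hom Φ Ψ := rightModuleTransformations Φ Ψ
  id Φ := ⟨𝟙 Φ.functor, fun X Y => by simp⟩
  comp {Φ Ψ Θ} σ τ := ⟨σ.1 ≫ τ.1, fun X Y => by
    have h₁ := σ.2 X Y
    have h₂ := τ.2 X Y
    simp only [NatTrans.comp_app, SemigroupCategory.comp_whiskerRight, Category.assoc]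
    rw [← h₂, ← Category.assoc, h₁, Category.assoc]⟩
  id_comp _ := Subtype.ext (Category.id_comp _)
  comp_id _ := Subtype.ext (Category.comp_id _)
  assoc _ _ _ := Subtype.ext (Category.assoc _ _ _)

/-- The category `S-Mod(S,S)` of left `S`-module endofunctors of `S`. -/
instance : Category (LeftModuleEndofunctor k S) where
  Hom Φ Ψ := leftModuleTransformations Φ Ψ
  id Φ := ⟨𝟙 Φ.functor, fun X Y => by simp⟩
  comp {Φ Ψ Θ} σ τ := ⟨σ.1 ≫ τ.1, fun X Y => by
    have h₁ := σ.2 X Y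
    have h₂ := τ.2 X Y
    simp only [NatTrans.comp_app, SemigroupCategory.whiskerLeft_comp, Category.assoc]
    rw [← h₂, ← Category.assoc, h₁, Category.assoc]⟩
  id_comp _ := Subtype.ext (Category.id_comp _)
  comp_id _ := Subtype.ext (Category.comp_id _)
  assoc _ _ _ := Subtype.ext (Category.assoc _ _ _)

instance : Preadditive (RightModuleEndofunctor k S) where
  homGroup Φ Ψ := inferInstanceAs (AddCommGroup (rightModuleTransformations Φ Ψ))
  add_comp _ _ _ _ _ _ := Subtype.ext (Preadditive.add_comp _ _ _ _ _ _)
  comp_add _ _ _ _ _ _ := Subtype.ext (Preadditive.comp_add _ _ _ _ _ _)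

instance : Linear k (RightModuleEndofunctor k S) where
  homModule Φ Ψ := inferInstanceAs (Module k (rightModuleTransformations Φ Ψ))
  smul_comp _ _ _ _ _ _ := Subtype.ext (Linear.smul_comp _ _ _ _ _ _)
  comp_smul _ _ _ _ _ _ := Subtype.ext (Linear.comp_smul _ _ _ _ _ _)

variable (k S)

/-- The identity functor of `S`, as a right `S`-module functor. -/
def RightModuleEndofunctor.identity : RightModuleEndofunctor k S where
  functor := 𝟭 S
  additive := inferInstance
  linear := inferInstance
  str X Y := Iso.refl _
  str_natural_left f Y := by simp
  str_natural_right X _ _ f := by simp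
  str_assoc X Y Z := by simp

/-- The identity functor of `S`, as a left `S`-module functor. -/
def LeftModuleEndofunctor.identity : LeftModuleEndofunctor k S where
  functor := 𝟭 S
  additive := inferInstance
  linear := inferInstance
  str X Y := Iso.refl _
  str_natural_left f Y := by simp
  str_natural_right X _ _ f := by simp
  str_assoc X Y Z := by simp

variable {S}

/-- The right `S`-module endofunctor `F ⊠ -`. -/
def leftMul (F : S) : RightModuleEndofunctor k S where
  functor :=
    { obj := fun X => F ⊠ X
      map := fun f => F ◁ₛ f
      map_id := fun X => SemigroupCategory.whiskerLeft_id F X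
      map_comp := fun f g => SemigroupCategory.whiskerLeft_comp F f g }
  additive := ⟨fun {_ _ f g} => LinearSemigroupCategory.whiskerLeft_add k F f g⟩
  linear := ⟨fun f r => LinearSemigroupCategory.whiskerLeft_smul F r f⟩
  str X Y := (αₛ F X Y).symm
  str_natural_left f Y := by
    have h := SemigroupCategory.associator_naturality_middle F f Y
    simp only [Iso.symm_hom, Iso.comp_inv_eq, Category.assoc, h, Iso.inv_hom_id_assoc]
  str_natural_right X _ _ f := by
    have h := SemigroupCategory.associator_naturality_right F X f
    simp only [Iso.symm_hom, Iso.comp_inv_eq, Category.assoc, h, Iso.inv_hom_id_assoc]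
  str_assoc X Y Z := by
    have h := SemigroupCategory.pentagon F X Y Z
    simp only [Iso.symm_hom]
    have e : (αₛ F X Y).inv ▷ₛ Z ≫ (αₛ F X Y).hom ▷ₛ Z = 𝟙 _ := by
      rw [← SemigroupCategory.comp_whiskerRight]
      simp
    rw [Iso.comp_inv_eq]
    simp only [Category.assoc]
    rw [← h, ← Category.assoc (_ ▷ₛ Z) (_ ▷ₛ Z), e, Category.id_comp, Iso.inv_hom_id_assoc]

/-- The left `S`-module endofunctor `- ⊠ F`. -/
def rightMul (F : S) : LeftModuleEndofunctor k S where
  functor :=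
    { obj := fun X => X ⊠ F
      map := fun f => f ▷ₛ F
      map_id := fun X => SemigroupCategory.id_whiskerRight X F
      map_comp := fun f g => SemigroupCategory.comp_whiskerRight f g F }
  additive := ⟨fun {_ _ f g} => LinearSemigroupCategory.add_whiskerRight k f g F⟩
  linear := ⟨fun f r => LinearSemigroupCategory.smul_whiskerRight r f F⟩
  str X Y := αₛ X Y F
  str_natural_left f Y := SemigroupCategory.associator_naturality_left f Y F
  str_natural_right X _ _ f := SemigroupCategory.associator_naturality_middle X f F
  str_assoc X Y Z := SemigroupCategory.pentagon X Y Z F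

variable (S)

/-- The functor `S ⥤ Mod-S(S,S)`, `F ↦ F ⊠ -`. -/
def leftMulFunctor : S ⥤ RightModuleEndofunctor k S where
  obj F := leftMul k F
  map {F G} f := ⟨{
      app := fun X => f ▷ₛ X
      naturality := fun _ _ g => SemigroupCategory.whisker_exchange f g }, fun X Y => by
    have h := SemigroupCategory.associator_naturality_left f X Y
    change (αₛ F X Y).inv ≫ (f ▷ₛ X) ▷ₛ Y = f ▷ₛ (X ⊠ Y) ≫ (αₛ G X Y).inv
    rw [Iso.eq_comp_inv, Category.assoc, h, Iso.inv_hom_id_assoc]⟩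
  map_id F := Subtype.ext (NatTrans.ext (funext fun X => SemigroupCategory.id_whiskerRight F X))
  map_comp f g := Subtype.ext (NatTrans.ext (funext fun X =>
    SemigroupCategory.comp_whiskerRight f g X))

/-! ### Adjunctions in a semigroup category -/

variable {S}

/-- A (non-unital) adjunction `(F, F', ηˡ, ηʳ, εˡ, εʳ)` in a semigroup category; `F'` is then a
right dual of `F`, and `F` is a left dual of `F'`. -/
structure SemigroupAdjunction (F F' : S) where
  ηl : LeftModuleEndofunctor.identity k S ⟶ rightMul k (F' ⊠ F)
  εl : rightMul k (F ⊠ F') ⟶ LeftModuleEndofunctor.identity k S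
  ηr : RightModuleEndofunctor.identity k S ⟶ leftMul k (F' ⊠ F)
  εr : leftMul k (F ⊠ F') ⟶ RightModuleEndofunctor.identity k S
  /-- The first zigzag equation for the adjunction `(- ⊠ F', - ⊠ F, ηˡ, εˡ)` in `S-Mod(S,S)`. -/
  left_triangle₁ (X : S) :
    (ηl.1.app X ▷ₛ F' : X ⊠ F' ⟶ (X ⊠ (F' ⊠ F)) ⊠ F') ≫ (αₛ X F' F).inv ▷ₛ F' ≫
      (αₛ (X ⊠ F') F F').hom ≫ (εl.1.app (X ⊠ F') : (X ⊠ F') ⊠ (F ⊠ F') ⟶ X ⊠ F') = 𝟙 (X ⊠ F')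
  /-- The second zigzag equation for the adjunction `(- ⊠ F', - ⊠ F, ηˡ, εˡ)`. -/
  left_triangle₂ (X : S) :
    (ηl.1.app (X ⊠ F) : X ⊠ F ⟶ (X ⊠ F) ⊠ (F' ⊠ F)) ≫ (αₛ (X ⊠ F) F' F).inv ≫
      (αₛ X F F').hom ▷ₛ F ≫ (εl.1.app X ▷ₛ F : (X ⊠ (F ⊠ F')) ⊠ F ⟶ X ⊠ F) = 𝟙 (X ⊠ F)
  /-- The first zigzag equation for the adjunction `(F ⊠ -, F' ⊠ -, ηʳ, εʳ)` in `Mod-S(S,S)`. -/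
  right_triangle₁ (X : S) :
    (F ◁ₛ ηr.1.app X : F ⊠ X ⟶ F ⊠ ((F' ⊠ F) ⊠ X)) ≫ F ◁ₛ (αₛ F' F X).hom ≫
      (αₛ F F' (F ⊠ X)).inv ≫ (εr.1.app (F ⊠ X) : (F ⊠ F') ⊠ (F ⊠ X) ⟶ F ⊠ X) = 𝟙 (F ⊠ X)
  /-- The second zigzag equation for the adjunction `(F ⊠ -, F' ⊠ -, ηʳ, εʳ)`. -/
  right_triangle₂ (X : S) :
    (ηr.1.app (F' ⊠ X) : F' ⊠ X ⟶ (F' ⊠ F) ⊠ (F' ⊠ X)) ≫ (αₛ F' F (F' ⊠ X)).hom ≫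
      F' ◁ₛ (αₛ F F' X).inv ≫ (F' ◁ₛ εr.1.app X : F' ⊠ ((F ⊠ F') ⊠ X) ⟶ F' ⊠ X) = 𝟙 (F' ⊠ X)
  zigzag :
    (ηl.1.app F : F ⟶ F ⊠ (F' ⊠ F)) ≫ (αₛ F F' F).inv ≫
      (εr.1.app F : (F ⊠ F') ⊠ F ⟶ F) = 𝟙 F
  zigzag' :
    (ηr.1.app F' : F' ⟶ (F' ⊠ F) ⊠ F') ≫ (αₛ F' F F').hom ≫
      (εl.1.app F' : F' ⊠ (F ⊠ F') ⟶ F') = 𝟙 F'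
  unit_compat (H K : S) :
    (H ◁ₛ ηr.1.app K : H ⊠ K ⟶ H ⊠ ((F' ⊠ F) ⊠ K)) ≫ (αₛ H (F' ⊠ F) K).inv =
      (ηl.1.app H ▷ₛ K : H ⊠ K ⟶ (H ⊠ (F' ⊠ F)) ⊠ K)
  counit_compat (H K : S) :
    (εl.1.app H ▷ₛ K : (H ⊠ (F ⊠ F')) ⊠ K ⟶ H ⊠ K) =
      (αₛ H (F ⊠ F') K).hom ≫ (H ◁ₛ εr.1.app K : H ⊠ ((F ⊠ F') ⊠ K) ⟶ H ⊠ K)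

variable (S)

/-- A semigroup category is rigid if each of its objects has both a right and a left dual. -/
def IsRigidSemigroupCategory : Prop :=
  ∀ F : S, (∃ F' : S, Nonempty (SemigroupAdjunction k F F')) ∧
    (∃ F' : S, Nonempty (SemigroupAdjunction k F' F))

end Modules

/-! ### Linear presheaves and Day convolution -/

section Presheaves

variable (k : Type w) [Field k] (S : Type u) [SmallCategory S] [Preadditive S] [Linear k S]

/-- `k`-linearity of a presheaf of `k`-vector spaces. -/
structure IsLinearPresheaf (P : Sᵒᵖ ⥤ ModuleCat.{u} k) : Prop where
  map_add {X Y : S} (f g : X ⟶ Y) : P.map (f + g).op = P.map f.op + P.map g.op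
  map_smul {X Y : S} (r : k) (f : X ⟶ Y) : P.map (r • f).op = r • P.map f.op

/-- The presheaf category `[Sᵒᵖ, Vec_k]`, consisting of the `k`-linear functors. -/
abbrev LinearPresheaf : Type (max w (u + 1)) :=
  ObjectProperty.FullSubcategory (IsLinearPresheaf k S)

variable {k S}

namespace LinearPresheaf

/-- The value of a presheaf. -/
abbrev value (P : LinearPresheaf k S) (X : S) : ModuleCat.{u} k := P.obj.obj (op X)

/-- The restriction map of a presheaf along a morphism. -/
def res (P : LinearPresheaf k S) {X Y : S} (f : X ⟶ Y) : P.value Y →ₗ[k] P.value X :=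
  (P.obj.map f.op).hom

variable (P : LinearPresheaf k S)

lemma res_id (X : S) (p : P.value X) : P.res (𝟙 X) p = p := by
  simp [res]

lemma res_comp {X Y Z : S} (f : X ⟶ Y) (g : Y ⟶ Z) (p : P.value Z) :
    P.res (f ≫ g) p = P.res f (P.res g p) := by
  simp [res]

lemma res_add {X Y : S} (f g : X ⟶ Y) (p : P.value Y) :
    P.res (f + g) p = P.res f p + P.res g p := by
  unfold res
  rw [P.property.map_add]
  rfl

lemma res_smul {X Y : S} (r : k) (f : X ⟶ Y) (p : P.value Y) :
    P.res (r • f) p = r • P.res f p := by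
  unfold res
  rw [P.property.map_smul]
  rfl

/-- The component of a morphism of presheaves. -/
def component {P Q : LinearPresheaf k S} (τ : P ⟶ Q) (X : S) : P.value X →ₗ[k] Q.value X :=
  (τ.hom.app (op X)).hom

variable {P} {Q R : LinearPresheaf k S}

lemma comp_res (τ : P ⟶ Q) {X Y : S} (f : X ⟶ Y) (p : P.value Y) :
    component τ X (P.res f p) = Q.res f (component τ Y p) :=
  congrArg (fun t => t.hom p) (τ.hom.naturality f.op)

lemma comp_comp (σ : P ⟶ Q) (τ : Q ⟶ R) (X : S) (p : P.value X) :
    component (σ ≫ τ) X p = component τ X (component σ X p) := rfl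

lemma comp_id (X : S) (p : P.value X) : component (𝟙 P) X p = p := rfl

lemma comp_add (σ τ : P ⟶ Q) (X : S) (p : P.value X) :
    component (σ + τ) X p = component σ X p + component τ X p := rfl

lemma comp_smul (r : k) (τ : P ⟶ Q) (X : S) (p : P.value X) :
    component (r • τ) X p = r • component τ X p := rfl

lemma ext_comp {σ τ : P ⟶ Q} (h : ∀ (X : S) (p : P.value X), component σ X p = component τ X p) : σ = τ := by
  apply ObjectProperty.hom_ext
  ext X p
  exact h X.unop p

/-- Construct a morphism of presheaves from its components. -/
def mkHom (φ : ∀ X : S, P.value X →ₗ[k] Q.value X)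
    (h : ∀ {X Y : S} (f : X ⟶ Y) (p : P.value Y), φ X (P.res f p) = Q.res f (φ Y p)) : P ⟶ Q :=
  ObjectProperty.homMk
    { app := fun X => ModuleCat.ofHom (φ X.unop)
      naturality := fun X Y f => by
        ext p
        exact h f.unop p }

lemma comp_mkHom (φ : ∀ X : S, P.value X →ₗ[k] Q.value X)
    (h : ∀ {X Y : S} (f : X ⟶ Y) (p : P.value Y), φ X (P.res f p) = Q.res f (φ Y p)) (X : S)
    (p : P.value X) : component (mkHom φ h) X p = φ X p := rfl

/-- Construct a presheaf from its values and restriction maps. -/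
def ofRes (V : S → ModuleCat.{u} k) (ρ : ∀ {X Y : S}, (X ⟶ Y) → (V Y →ₗ[k] V X))
    (ρ_id : ∀ X v, ρ (𝟙 X) v = v)
    (ρ_comp : ∀ {X Y Z : S} (f : X ⟶ Y) (g : Y ⟶ Z) v, ρ (f ≫ g) v = ρ f (ρ g v))
    (ρ_add : ∀ {X Y : S} (f g : X ⟶ Y) v, ρ (f + g) v = ρ f v + ρ g v)
    (ρ_smul : ∀ {X Y : S} (r : k) (f : X ⟶ Y) v, ρ (r • f) v = r • ρ f v) :
    LinearPresheaf k S where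
  obj :=
    { obj := fun X => V X.unop
      map := fun f => ModuleCat.ofHom (ρ f.unop)
      map_id := fun X => by ext v; exact ρ_id _ v
      map_comp := fun f g => by ext v; exact ρ_comp _ _ v }
  property :=
    { map_add := fun f g => by ext v; exact ρ_add f g v
      map_smul := fun r f => by ext v; exact ρ_smul r f v }

end LinearPresheaf

variable (k S)

/-- The (linear) Yoneda embedding `S ⥤ [Sᵒᵖ, Vec_k]`, `F ↦ Hom(-, F)`. -/
def yonedaEmbedding : S ⥤ LinearPresheaf k S where
  obj F :=
    { obj := (linearYoneda k S).obj F
      property :=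
        { map_add := fun f g => by ext h; exact Preadditive.add_comp _ _ _ f g h
          map_smul := fun r f => by ext h; exact Linear.smul_comp _ _ _ r f h } }
  map f := ObjectProperty.homMk ((linearYoneda k S).map f)
  map_id F := ObjectProperty.hom_ext _ ((linearYoneda k S).map_id F)
  map_comp f g := ObjectProperty.hom_ext _ ((linearYoneda k S).map_comp f g)

instance : (yonedaEmbedding k S).Additive where
  map_add {_ _ f g} := LinearPresheaf.ext_comp fun _ h => Preadditive.comp_add _ _ _ h f g

instance : (yonedaEmbedding k S).Linear k where
  map_smul f r := LinearPresheaf.ext_comp fun _ h => Linear.comp_smul _ _ _ h r f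

variable [SemigroupCategory S]

section

variable [LinearSemigroupCategory k S]

lemma leftMulFunctor_map_add {F G : S} (f g : F ⟶ G) :
    (leftMulFunctor k S).map (f + g) = (leftMulFunctor k S).map f + (leftMulFunctor k S).map g :=
  Subtype.ext (NatTrans.ext (funext fun X => LinearSemigroupCategory.add_whiskerRight k f g X))

lemma leftMulFunctor_map_smul {F G : S} (r : k) (f : F ⟶ G) :
    (leftMulFunctor k S).map (r • f) = r • (leftMulFunctor k S).map f :=
  Subtype.ext (NatTrans.ext (funext fun X => LinearSemigroupCategory.smul_whiskerRight r f X))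

/-- The presheaf `F ↦ Hom(F ⊠ -, Id)`, with morphisms taken in `Mod-S(S,S)`. -/
def unitPresheaf : LinearPresheaf k S where
  obj := (leftMulFunctor k S).op ⋙
    (linearYoneda k (RightModuleEndofunctor k S)).obj (RightModuleEndofunctor.identity k S)
  property :=
    { map_add := fun f g => by
        ext τ
        exact (congrArg (· ≫ τ) (leftMulFunctor_map_add k S f g)).trans
          (Preadditive.add_comp _ _ _ _ _ _)
      map_smul := fun r f => by
        ext τ
        exact (congrArg (· ≫ τ) (leftMulFunctor_map_smul k S r f)).trans
          (Linear.smul_comp _ _ _ _ _ _) }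

end

variable {k S}

/-- The functor `((H', K'), (H, K)) ↦ Hom(F, H ⊠ K) ⊗ P(H') ⊗ Q(K')`. -/
def dayIntegrand (P Q : LinearPresheaf k S) (F : S) :
    (S × S)ᵒᵖ ⥤ (S × S) ⥤ ModuleCat.{u} k where
  obj A :=
    { obj := fun B =>
        ModuleCat.of k ((F ⟶ B.1 ⊠ B.2) ⊗[k] (P.value A.unop.1 ⊗[k] Q.value A.unop.2))
      map := fun {B B'} g => ModuleCat.ofHom
        (TensorProduct.map (Linear.rightComp k F (g.1 ▷ₛ B.2 ≫ B'.1 ◁ₛ g.2)) LinearMap.id)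
      map_id := fun B => by
        apply ModuleCat.hom_ext
        ext f p q
        simp
      map_comp := fun {B B' B''} g h => by
        apply ModuleCat.hom_ext
        ext f p q
        have e : (g.1 ≫ h.1) ▷ₛ B.2 ≫ B''.1 ◁ₛ (g.2 ≫ h.2) =
            (g.1 ▷ₛ B.2 ≫ B'.1 ◁ₛ g.2) ≫ (h.1 ▷ₛ B'.2 ≫ B''.1 ◁ₛ h.2) := by
          rw [SemigroupCategory.comp_whiskerRight, SemigroupCategory.whiskerLeft_comp,
            Category.assoc, Category.assoc, ← Category.assoc (B'.1 ◁ₛ g.2),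
            SemigroupCategory.whisker_exchange, Category.assoc]
        simp [e] }
  map {A A'} g :=
    { app := fun B => ModuleCat.ofHom
        (TensorProduct.map LinearMap.id (TensorProduct.map (P.res g.unop.1) (Q.res g.unop.2)))
      naturality := fun B B' h => by
        apply ModuleCat.hom_ext
        ext f p q
        simp }
  map_id A := by
    ext B : 2
    apply ModuleCat.hom_ext
    ext f p q
    simp [LinearPresheaf.res_id]
  map_comp g h := by
    ext B : 2
    apply ModuleCat.hom_ext
    ext f p q
    simp [LinearPresheaf.res_comp]

/-- The elements of `∫^{H,K} Hom(F, H ⊠ K) ⊗ P(H) ⊗ Q(K)`. -/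
noncomputable def dayValue (P Q : LinearPresheaf k S) (F : S) : ModuleCat.{u} k :=
  Limits.coend (dayIntegrand P Q F)

/-- The canonical map to the coend from its `(H, K)`-th summand. -/
noncomputable def dayι (P Q : LinearPresheaf k S) (F H K : S) :
    (F ⟶ H ⊠ K) ⊗[k] (P.value H ⊗[k] Q.value K) →ₗ[k] dayValue P Q F :=
  (Limits.coend.ι (dayIntegrand P Q F) (H, K)).hom

/-- The class of `f ⊗ p ⊗ q` in the coend. -/
noncomputable def dayMk (P Q : LinearPresheaf k S) {F H K : S} (f : F ⟶ H ⊠ K) (p : P.value H)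
    (q : Q.value K) : dayValue P Q F :=
  dayι P Q F H K (f ⊗ₜ[k] (p ⊗ₜ[k] q))

section

variable {P Q : LinearPresheaf k S} {F H K : S}

lemma dayMk_add_hom (f f' : F ⟶ H ⊠ K) (p : P.value H) (q : Q.value K) :
    dayMk P Q (f + f') p q = dayMk P Q f p q + dayMk P Q f' p q := by
  unfold dayMk
  rw [TensorProduct.add_tmul, map_add]

lemma dayMk_smul_hom (r : k) (f : F ⟶ H ⊠ K) (p : P.value H) (q : Q.value K) :
    dayMk P Q (r • f) p q = r • dayMk P Q f p q := by
  unfold dayMk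
  rw [← TensorProduct.smul_tmul', map_smul]

lemma dayMk_add_left (f : F ⟶ H ⊠ K) (p p' : P.value H) (q : Q.value K) :
    dayMk P Q f (p + p') q = dayMk P Q f p q + dayMk P Q f p' q := by
  unfold dayMk
  rw [TensorProduct.add_tmul, TensorProduct.tmul_add, map_add]

lemma dayMk_smul_left (r : k) (f : F ⟶ H ⊠ K) (p : P.value H) (q : Q.value K) :
    dayMk P Q f (r • p) q = r • dayMk P Q f p q := by
  unfold dayMk
  rw [← TensorProduct.smul_tmul', TensorProduct.tmul_smul, map_smul]

lemma dayMk_add_right (f : F ⟶ H ⊠ K) (p : P.value H) (q q' : Q.value K) :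
    dayMk P Q f p (q + q') = dayMk P Q f p q + dayMk P Q f p q' := by
  unfold dayMk
  rw [TensorProduct.tmul_add, TensorProduct.tmul_add, map_add]

lemma dayMk_smul_right (r : k) (f : F ⟶ H ⊠ K) (p : P.value H) (q : Q.value K) :
    dayMk P Q f p (r • q) = r • dayMk P Q f p q := by
  unfold dayMk
  rw [TensorProduct.tmul_smul, TensorProduct.tmul_smul, map_smul]

/-- The defining relation of the coend. -/
lemma dayMk_condition {H' K' : S} (f : F ⟶ H ⊠ K) (g : H ⟶ H') (h : K ⟶ K')
    (p : P.value H') (q : Q.value K') :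
    dayMk P Q f (P.res g p) (Q.res h q) = dayMk P Q (f ≫ g ▷ₛ K ≫ H' ◁ₛ h) p q :=
  congrArg (fun t => t.hom (f ⊗ₜ[k] (p ⊗ₜ[k] q)))
    (Limits.coend.condition (dayIntegrand P Q F) (i := (H, K)) (j := (H', K')) (g, h))

lemma dayMk_res_left {H' : S} (f : F ⟶ H ⊠ K) (g : H ⟶ H') (p : P.value H') (q : Q.value K) :
    dayMk P Q f (P.res g p) q = dayMk P Q (f ≫ g ▷ₛ K) p q := by
  have h := dayMk_condition f g (𝟙 K) p q
  simpa [LinearPresheaf.res_id] using h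

lemma dayMk_res_right {K' : S} (f : F ⟶ H ⊠ K) (h : K ⟶ K') (p : P.value H) (q : Q.value K') :
    dayMk P Q f p (Q.res h q) = dayMk P Q (f ≫ H ◁ₛ h) p q := by
  have h := dayMk_condition f (𝟙 H) h p q
  simpa [LinearPresheaf.res_id] using h

/-- Linear maps out of the coend are determined by their values on the classes `f ⊗ p ⊗ q`. -/
lemma dayValue_hom_ext {V : Type u} [AddCommGroup V] [Module k V]
    {φ ψ : dayValue P Q F →ₗ[k] V}
    (h : ∀ (H K : S) (f : F ⟶ H ⊠ K) (p : P.value H) (q : Q.value K),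
      φ (dayMk P Q f p q) = ψ (dayMk P Q f p q)) : φ = ψ := by
  have e : ModuleCat.ofHom φ = ModuleCat.ofHom ψ := by
    apply Limits.coend.hom_ext
    rintro ⟨H, K⟩
    apply ModuleCat.hom_ext
    have e' : φ ∘ₗ dayι P Q F H K = ψ ∘ₗ dayι P Q F H K := by
      ext f p q
      exact h H K f p q
    exact e'
  exact congrArg ModuleCat.Hom.hom e

/-- A trilinear map, as a linear map on the triple tensor product. -/
def dayUncurry {V : Type u} [AddCommGroup V] [Module k V]
    (φ : (F ⟶ H ⊠ K) →ₗ[k] P.value H →ₗ[k] Q.value K →ₗ[k] V) :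
    (F ⟶ H ⊠ K) ⊗[k] (P.value H ⊗[k] Q.value K) →ₗ[k] V :=
  TensorProduct.lift (TensorProduct.uncurry (.id k) (P.value H) (Q.value K) V ∘ₗ φ)

lemma dayUncurry_compat {V : Type u} [AddCommGroup V] [Module k V]
    (φ : ∀ H K : S, (F ⟶ H ⊠ K) →ₗ[k] P.value H →ₗ[k] Q.value K →ₗ[k] V)
    (hφ : ∀ {H K H' K' : S} (f : F ⟶ H ⊠ K) (g : H ⟶ H') (h : K ⟶ K')
      (p : P.value H') (q : Q.value K'),
      φ H K f (P.res g p) (Q.res h q) = φ H' K' (f ≫ g ▷ₛ K ≫ H' ◁ₛ h) p q)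
    {A B : S × S} (g : A ⟶ B) :
    ((dayIntegrand P Q F).map g.op).app A ≫ ModuleCat.ofHom (dayUncurry (φ A.1 A.2)) =
      ((dayIntegrand P Q F).obj (op B)).map g ≫ ModuleCat.ofHom (dayUncurry (φ B.1 B.2)) := by
  apply ModuleCat.hom_ext
  have e : dayUncurry (φ A.1 A.2) ∘ₗ
        TensorProduct.map LinearMap.id (TensorProduct.map (P.res g.1) (Q.res g.2)) =
      dayUncurry (φ B.1 B.2) ∘ₗ
        TensorProduct.map (Linear.rightComp k F (g.1 ▷ₛ A.2 ≫ B.1 ◁ₛ g.2)) LinearMap.id := by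
    ext f p q
    exact hφ f g.1 g.2 p q
  exact e

/-- Linear maps out of the coend, from compatible trilinear maps. -/
noncomputable def dayValueDesc {V : Type u} [AddCommGroup V] [Module k V]
    (φ : ∀ H K : S, (F ⟶ H ⊠ K) →ₗ[k] P.value H →ₗ[k] Q.value K →ₗ[k] V)
    (hφ : ∀ {H K H' K' : S} (f : F ⟶ H ⊠ K) (g : H ⟶ H') (h : K ⟶ K')
      (p : P.value H') (q : Q.value K'),
      φ H K f (P.res g p) (Q.res h q) = φ H' K' (f ≫ g ▷ₛ K ≫ H' ◁ₛ h) p q) :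
    dayValue P Q F →ₗ[k] V :=
  (Limits.coend.desc (F := dayIntegrand P Q F) (X := ModuleCat.of k V)
    (fun A => ModuleCat.ofHom (dayUncurry (φ A.1 A.2)))
    (fun _ _ g => dayUncurry_compat φ hφ g)).hom

lemma dayValueDesc_mk {V : Type u} [AddCommGroup V] [Module k V]
    (φ : ∀ H K : S, (F ⟶ H ⊠ K) →ₗ[k] P.value H →ₗ[k] Q.value K →ₗ[k] V)
    (hφ : ∀ {H K H' K' : S} (f : F ⟶ H ⊠ K) (g : H ⟶ H') (h : K ⟶ K')
      (p : P.value H') (q : Q.value K'),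
      φ H K f (P.res g p) (Q.res h q) = φ H' K' (f ≫ g ▷ₛ K ≫ H' ◁ₛ h) p q)
    (f : F ⟶ H ⊠ K) (p : P.value H) (q : Q.value K) :
    dayValueDesc φ hφ (dayMk P Q f p q) = φ H K f p q := by
  have h := Limits.coend.ι_desc (F := dayIntegrand P Q F) (X := ModuleCat.of k V)
    (fun A => ModuleCat.ofHom (dayUncurry (φ A.1 A.2)))
    (fun _ _ g => dayUncurry_compat φ hφ g) (H, K)
  exact congrArg (fun t => t.hom (f ⊗ₜ[k] (p ⊗ₜ[k] q))) h

end

/-- The trilinear map `(f, p, q) ↦ [t(f) ⊗ a(p) ⊗ b(q)]`. -/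
noncomputable def dayMkLinear {P Q P' Q' : LinearPresheaf k S} {F G H K : S}
    (t : (G ⟶ H ⊠ K) →ₗ[k] (F ⟶ H ⊠ K)) (a : P.value H →ₗ[k] P'.value H)
    (b : Q.value K →ₗ[k] Q'.value K) :
    (G ⟶ H ⊠ K) →ₗ[k] P.value H →ₗ[k] Q.value K →ₗ[k] dayValue P' Q' F :=
  LinearMap.mk₂ k
    (fun f p =>
      { toFun := fun q => dayMk P' Q' (t f) (a p) (b q)
        map_add' := fun q q' => by simp [dayMk_add_right]
        map_smul' := fun r q => by simp [dayMk_smul_right] })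
    (fun f f' p => by
      ext q
      simp [dayMk_add_hom])
    (fun r f p => by
      ext q
      simp [dayMk_smul_hom])
    (fun f p p' => by
      ext q
      simp [dayMk_add_left])
    (fun r f p => by
      ext q
      simp [dayMk_smul_left])

/-- The action of a morphism `F ⟶ G` on the coend. -/
noncomputable def dayRes (P Q : LinearPresheaf k S) {F G : S} (g : F ⟶ G) :
    dayValue P Q G →ₗ[k] dayValue P Q F :=
  dayValueDesc
    (fun H K => dayMkLinear (Linear.leftComp k (H ⊠ K) g) LinearMap.id LinearMap.id)
    (fun f g' h p q => by
      simp [dayMkLinear, dayMk_condition])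

lemma dayRes_mk (P Q : LinearPresheaf k S) {F G H K : S} (g : F ⟶ G) (f : G ⟶ H ⊠ K)
    (p : P.value H) (q : Q.value K) :
    dayRes P Q g (dayMk P Q f p q) = dayMk P Q (g ≫ f) p q := by
  unfold dayRes
  rw [dayValueDesc_mk]
  · rfl
  · intros
    simp [dayMkLinear, dayMk_condition]

/-- The Day convolution of two presheaves,
`(P ⊛ Q)(-) = ∫^{H,K} Hom(-, H ⊠ K) ⊗ P(H) ⊗ Q(K)`. -/
noncomputable def dayConvolution (P Q : LinearPresheaf k S) : LinearPresheaf k S :=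
  LinearPresheaf.ofRes (dayValue P Q) (dayRes P Q)
    (fun X v => LinearMap.congr_fun (f := dayRes P Q (𝟙 X)) (g := LinearMap.id)
      (dayValue_hom_ext fun H K f p q => by simp [dayRes_mk]) v)
    (fun {X Y Z} f g v => LinearMap.congr_fun (f := dayRes P Q (f ≫ g))
      (g := dayRes P Q f ∘ₗ dayRes P Q g)
      (dayValue_hom_ext fun H K f p q => by simp [dayRes_mk]) v)
    (fun f g v => LinearMap.congr_fun (f := dayRes P Q (f + g)) (g := dayRes P Q f + dayRes P Q g)
      (dayValue_hom_ext fun H K f p q => by simp [dayRes_mk, dayMk_add_hom]) v)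
    (fun r f v => LinearMap.congr_fun (f := dayRes P Q (r • f)) (g := r • dayRes P Q f)
      (dayValue_hom_ext fun H K f p q => by simp [dayRes_mk, dayMk_smul_hom]) v)

/-- The class of `id ⊗ p ⊗ q` in `(P ⊛ Q)(H ⊠ K)`. -/
noncomputable def dayPure {P Q : LinearPresheaf k S} {H K : S} (p : P.value H) (q : Q.value K) :
    (dayConvolution P Q).value (H ⊠ K) :=
  dayMk P Q (𝟙 (H ⊠ K)) p q

section

variable {P Q R : LinearPresheaf k S} {H K : S}

lemma dayRes_pure {F : S} (f : F ⟶ H ⊠ K) (p : P.value H) (q : Q.value K) :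
    (dayConvolution P Q).res f (dayPure p q) = dayMk P Q f p q :=
  (dayRes_mk P Q f (𝟙 (H ⊠ K)) p q).trans (by rw [Category.comp_id])

lemma dayPure_add_left (p p' : P.value H) (q : Q.value K) :
    dayPure (p + p') q = dayPure p q + dayPure p' q := dayMk_add_left _ p p' q

lemma dayPure_smul_left (r : k) (p : P.value H) (q : Q.value K) :
    dayPure (r • p) q = r • dayPure p q := dayMk_smul_left r _ p q

lemma dayPure_add_right (p : P.value H) (q q' : Q.value K) :
    dayPure p (q + q') = dayPure p q + dayPure p q' := dayMk_add_right _ p q q'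

lemma dayPure_smul_right (r : k) (p : P.value H) (q : Q.value K) :
    dayPure p (r • q) = r • dayPure p q := dayMk_smul_right r _ p q

lemma dayPure_res_left {H' : S} (g : H ⟶ H') (p : P.value H') (q : Q.value K) :
    dayPure (P.res g p) q = (dayConvolution P Q).res (g ▷ₛ K) (dayPure p q) := by
  rw [dayRes_pure]
  exact (dayMk_res_left _ g p q).trans (by rw [Category.id_comp])

lemma dayPure_res_right {K' : S} (g : K ⟶ K') (p : P.value H) (q : Q.value K') :
    dayPure p (Q.res g q) = (dayConvolution P Q).res (H ◁ₛ g) (dayPure p q) := by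
  rw [dayRes_pure]
  exact (dayMk_res_right _ g p q).trans (by rw [Category.id_comp])

lemma day_linearMap_ext {F : S} {V : Type u} [AddCommGroup V] [Module k V]
    {φ ψ : (dayConvolution P Q).value F →ₗ[k] V}
    (h : ∀ (H K : S) (f : F ⟶ H ⊠ K) (p : P.value H) (q : Q.value K),
      φ ((dayConvolution P Q).res f (dayPure p q)) =
        ψ ((dayConvolution P Q).res f (dayPure p q))) : φ = ψ := by
  apply dayValue_hom_ext
  intro H K f p q
  have := h H K f p q
  rwa [dayRes_pure] at this

/-- Morphisms out of a Day convolution are determined by their values on the classes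
`id ⊗ p ⊗ q`. -/
lemma day_hom_ext {σ τ : dayConvolution P Q ⟶ R}
    (h : ∀ (H K : S) (p : P.value H) (q : Q.value K),
      LinearPresheaf.component σ (H ⊠ K) (dayPure p q) =
        LinearPresheaf.component τ (H ⊠ K) (dayPure p q)) : σ = τ := by
  apply LinearPresheaf.ext_comp
  intro F x
  refine LinearMap.congr_fun (day_linearMap_ext fun H K f p q => ?_) x
  rw [LinearPresheaf.comp_res, LinearPresheaf.comp_res, h]

variable (P Q R) in
/-- A natural family of bilinear maps `P(H) × Q(K) → R(H ⊠ K)`. -/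
structure DayFamily where
  map {H K : S} (p : P.value H) (q : Q.value K) : R.value (H ⊠ K)
  add_left {H K : S} (p p' : P.value H) (q : Q.value K) : map (p + p') q = map p q + map p' q
  smul_left {H K : S} (r : k) (p : P.value H) (q : Q.value K) : map (r • p) q = r • map p q
  add_right {H K : S} (p : P.value H) (q q' : Q.value K) : map p (q + q') = map p q + map p q'
  smul_right {H K : S} (r : k) (p : P.value H) (q : Q.value K) : map p (r • q) = r • map p q
  res_left {H H' K : S} (g : H ⟶ H') (p : P.value H') (q : Q.value K) :
    map (P.res g p) q = R.res (g ▷ₛ K) (map p q)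
  res_right {H K K' : S} (g : K ⟶ K') (p : P.value H) (q : Q.value K') :
    map p (Q.res g q) = R.res (H ◁ₛ g) (map p q)

/-- The trilinear map `(f, p, q) ↦ R(f)(φ(p, q))`. -/
def DayFamily.trilinear (φ : DayFamily P Q R) (F H K : S) :
    (F ⟶ H ⊠ K) →ₗ[k] P.value H →ₗ[k] Q.value K →ₗ[k] R.value F :=
  LinearMap.mk₂ k
    (fun f p =>
      { toFun := fun q => R.res f (φ.map p q)
        map_add' := fun q q' => by simp [φ.add_right]
        map_smul' := fun r q => by simp [φ.smul_right] })
    (fun f f' p => by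
      ext q
      simp [LinearPresheaf.res_add])
    (fun r f p => by
      ext q
      simp [LinearPresheaf.res_smul])
    (fun f p p' => by
      ext q
      simp [φ.add_left])
    (fun r f p => by
      ext q
      simp [φ.smul_left])

lemma DayFamily.trilinear_compat (φ : DayFamily P Q R) (F : S) {H K H' K' : S} (f : F ⟶ H ⊠ K)
    (g : H ⟶ H') (h : K ⟶ K') (p : P.value H') (q : Q.value K') :
    φ.trilinear F H K f (P.res g p) (Q.res h q) =
      φ.trilinear F H' K' (f ≫ g ▷ₛ K ≫ H' ◁ₛ h) p q := by
  change R.res f (φ.map (P.res g p) (Q.res h q)) = R.res (f ≫ g ▷ₛ K ≫ H' ◁ₛ h) (φ.map p q)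
  rw [φ.res_left, φ.res_right, LinearPresheaf.res_comp, LinearPresheaf.res_comp]

/-- The universal property of the Day convolution. -/
noncomputable def dayLift (φ : DayFamily P Q R) : dayConvolution P Q ⟶ R :=
  LinearPresheaf.mkHom
    (fun F => (dayValueDesc (φ.trilinear F) (φ.trilinear_compat F) :
      dayValue P Q F →ₗ[k] R.value F))
    (fun {F G} f x => by
      refine LinearMap.congr_fun
        (f := dayValueDesc (φ.trilinear F) (φ.trilinear_compat F) ∘ₗ dayRes P Q f)
        (g := R.res f ∘ₗ dayValueDesc (φ.trilinear G) (φ.trilinear_compat G))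
        (dayValue_hom_ext fun H K g p q => ?_) x
      rw [LinearMap.comp_apply, LinearMap.comp_apply, dayRes_mk, dayValueDesc_mk, dayValueDesc_mk]
      exact LinearPresheaf.res_comp R f g _)

lemma dayLift_pure (φ : DayFamily P Q R) (p : P.value H) (q : Q.value K) :
    LinearPresheaf.component (dayLift φ) (H ⊠ K) (dayPure p q) = φ.map p q :=
  (dayValueDesc_mk (φ.trilinear (H ⊠ K)) (φ.trilinear_compat (H ⊠ K)) (𝟙 (H ⊠ K)) p q).trans
    (LinearPresheaf.res_id R _ _)

end

section

variable {P Q R T : LinearPresheaf k S}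

variable (P) in
/-- Day convolution with `P` on the left, on morphisms. -/
noncomputable def dayWhiskerLeft (τ : Q ⟶ R) : dayConvolution P Q ⟶ dayConvolution P R :=
  dayLift
    { map := fun {_ K} p q => dayPure p (LinearPresheaf.component τ K q)
      add_left := fun p p' q => dayPure_add_left _ _ _
      smul_left := fun r p q => dayPure_smul_left _ _ _
      add_right := fun p q q' => by rw [map_add, dayPure_add_right]
      smul_right := fun r p q => by rw [map_smul, dayPure_smul_right]
      res_left := fun g p q => dayPure_res_left _ _ _
      res_right := fun g p q => by rw [LinearPresheaf.comp_res, dayPure_res_right] }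

variable (R) in
/-- Day convolution with `R` on the right, on morphisms. -/
noncomputable def dayWhiskerRight (τ : P ⟶ Q) : dayConvolution P R ⟶ dayConvolution Q R :=
  dayLift
    { map := fun {H _} p q => dayPure (LinearPresheaf.component τ H p) q
      add_left := fun p p' q => by rw [map_add, dayPure_add_left]
      smul_left := fun r p q => by rw [map_smul, dayPure_smul_left]
      add_right := fun p q q' => dayPure_add_right _ _ _
      smul_right := fun r p q => dayPure_smul_right _ _ _
      res_left := fun g p q => by rw [LinearPresheaf.comp_res, dayPure_res_left]
      res_right := fun g p q => dayPure_res_right _ _ _ }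

lemma dayWhiskerLeft_pure (τ : Q ⟶ R) {H K : S} (p : P.value H) (q : Q.value K) :
    LinearPresheaf.component (dayWhiskerLeft P τ) (H ⊠ K) (dayPure p q) =
      dayPure p (LinearPresheaf.component τ K q) := dayLift_pure _ _ _

lemma dayWhiskerRight_pure (τ : P ⟶ Q) {H K : S} (p : P.value H) (r : R.value K) :
    LinearPresheaf.component (dayWhiskerRight R τ) (H ⊠ K) (dayPure p r) =
      dayPure (LinearPresheaf.component τ H p) r := dayLift_pure _ _ _

lemma day_hom_ext_left {σ τ : dayConvolution (dayConvolution P Q) R ⟶ T}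
    (h : ∀ (H L K : S) (p : P.value H) (q : Q.value L) (r : R.value K),
      LinearPresheaf.component σ ((H ⊠ L) ⊠ K) (dayPure (dayPure p q) r) =
        LinearPresheaf.component τ ((H ⊠ L) ⊠ K) (dayPure (dayPure p q) r)) : σ = τ := by
  apply day_hom_ext
  intro A K x r
  let pureMap : (dayConvolution P Q).value A →ₗ[k]
      (dayConvolution (dayConvolution P Q) R).value (A ⊠ K) :=
    { toFun := fun x => dayPure x r
      map_add' := fun x x' => dayPure_add_left x x' r
      map_smul' := fun c x => dayPure_smul_left c x r }
  refine LinearMap.congr_fun (f := LinearPresheaf.component σ (A ⊠ K) ∘ₗ pureMap)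
    (g := LinearPresheaf.component τ (A ⊠ K) ∘ₗ pureMap)
    (day_linearMap_ext fun H L f p q => ?_) x
  change LinearPresheaf.component σ (A ⊠ K) (dayPure _ r) =
    LinearPresheaf.component τ (A ⊠ K) (dayPure _ r)
  rw [dayPure_res_left, LinearPresheaf.comp_res, LinearPresheaf.comp_res, h]

lemma day_hom_ext_right {σ τ : dayConvolution P (dayConvolution Q R) ⟶ T}
    (h : ∀ (H L K : S) (p : P.value H) (q : Q.value L) (r : R.value K),
      LinearPresheaf.component σ (H ⊠ (L ⊠ K)) (dayPure p (dayPure q r)) =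
        LinearPresheaf.component τ (H ⊠ (L ⊠ K)) (dayPure p (dayPure q r))) : σ = τ := by
  apply day_hom_ext
  intro H A p x
  let pureMap : (dayConvolution Q R).value A →ₗ[k]
      (dayConvolution P (dayConvolution Q R)).value (H ⊠ A) :=
    { toFun := fun x => dayPure p x
      map_add' := fun x x' => dayPure_add_right p x x'
      map_smul' := fun c x => dayPure_smul_right c p x }
  refine LinearMap.congr_fun (f := LinearPresheaf.component σ (H ⊠ A) ∘ₗ pureMap)
    (g := LinearPresheaf.component τ (H ⊠ A) ∘ₗ pureMap)
    (day_linearMap_ext fun L K f q r => ?_) x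
  change LinearPresheaf.component σ (H ⊠ A) (dayPure p _) =
    LinearPresheaf.component τ (H ⊠ A) (dayPure p _)
  rw [dayPure_res_right, LinearPresheaf.comp_res, LinearPresheaf.comp_res, h]

end

lemma dayWhiskerLeft_add (P : LinearPresheaf k S) {Q R : LinearPresheaf k S} (σ τ : Q ⟶ R) :
    dayWhiskerLeft P (σ + τ) = dayWhiskerLeft P σ + dayWhiskerLeft P τ :=
  day_hom_ext fun H K p q => by
    simp only [LinearPresheaf.comp_add, dayWhiskerLeft_pure, dayPure_add_right]

lemma dayWhiskerLeft_smul (P : LinearPresheaf k S) {Q R : LinearPresheaf k S} (c : k)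
    (σ : Q ⟶ R) : dayWhiskerLeft P (c • σ) = c • dayWhiskerLeft P σ :=
  day_hom_ext fun H K p q => by
    simp only [LinearPresheaf.comp_smul, dayWhiskerLeft_pure, dayPure_smul_right]

lemma dayWhiskerRight_add {P Q : LinearPresheaf k S} (R : LinearPresheaf k S) (σ τ : P ⟶ Q) :
    dayWhiskerRight R (σ + τ) = dayWhiskerRight R σ + dayWhiskerRight R τ :=
  day_hom_ext fun H K p q => by
    simp only [LinearPresheaf.comp_add, dayWhiskerRight_pure, dayPure_add_left]

lemma dayWhiskerRight_smul {P Q : LinearPresheaf k S} (R : LinearPresheaf k S) (c : k)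
    (σ : P ⟶ Q) : dayWhiskerRight R (c • σ) = c • dayWhiskerRight R σ :=
  day_hom_ext fun H K p q => by
    simp only [LinearPresheaf.comp_smul, dayWhiskerRight_pure, dayPure_smul_left]

/-! ### The semigroup structure on presheaves -/

variable [LinearSemigroupCategory k S]

/-- The presheaf `T(- ⊠ K)`. -/
def LinearPresheaf.shiftRight (T : LinearPresheaf k S) (K : S) : LinearPresheaf k S :=
  LinearPresheaf.ofRes (fun A => T.value (A ⊠ K)) (fun f => T.res (f ▷ₛ K))
    (fun X v => by rw [SemigroupCategory.id_whiskerRight, LinearPresheaf.res_id])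
    (fun f g v => by rw [SemigroupCategory.comp_whiskerRight, LinearPresheaf.res_comp])
    (fun f g v => by rw [LinearSemigroupCategory.add_whiskerRight k, LinearPresheaf.res_add])
    (fun r f v => by rw [LinearSemigroupCategory.smul_whiskerRight, LinearPresheaf.res_smul])

/-- The morphism `T(- ⊠ K') ⟶ T(- ⊠ K)` given by `g : K ⟶ K'`. -/
def LinearPresheaf.shiftRightMap (T : LinearPresheaf k S) {K K' : S} (g : K ⟶ K') :
    T.shiftRight K' ⟶ T.shiftRight K :=
  LinearPresheaf.mkHom (P := T.shiftRight K') (Q := T.shiftRight K) (fun A => T.res (A ◁ₛ g))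
    (fun {A B} f (t : T.value (B ⊠ K')) => by
      change T.res (A ◁ₛ g) (T.res (f ▷ₛ K') t) = T.res (f ▷ₛ K) (T.res (B ◁ₛ g) t)
      rw [← LinearPresheaf.res_comp, ← LinearPresheaf.res_comp,
        SemigroupCategory.whisker_exchange])

/-- The presheaf `T(H ⊠ -)`. -/
def LinearPresheaf.shiftLeft (T : LinearPresheaf k S) (H : S) : LinearPresheaf k S :=
  LinearPresheaf.ofRes (fun A => T.value (H ⊠ A)) (fun f => T.res (H ◁ₛ f))
    (fun X v => by rw [SemigroupCategory.whiskerLeft_id, LinearPresheaf.res_id])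
    (fun f g v => by rw [SemigroupCategory.whiskerLeft_comp, LinearPresheaf.res_comp])
    (fun f g v => by rw [LinearSemigroupCategory.whiskerLeft_add k, LinearPresheaf.res_add])
    (fun r f v => by rw [LinearSemigroupCategory.whiskerLeft_smul, LinearPresheaf.res_smul])

/-- The morphism `T(H' ⊠ -) ⟶ T(H ⊠ -)` given by `g : H ⟶ H'`. -/
def LinearPresheaf.shiftLeftMap (T : LinearPresheaf k S) {H H' : S} (g : H ⟶ H') :
    T.shiftLeft H' ⟶ T.shiftLeft H :=
  LinearPresheaf.mkHom (P := T.shiftLeft H') (Q := T.shiftLeft H) (fun A => T.res (g ▷ₛ A))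
    (fun {A B} f (t : T.value (H' ⊠ B)) => by
      change T.res (g ▷ₛ A) (T.res (H' ◁ₛ f) t) = T.res (H ◁ₛ f) (T.res (g ▷ₛ B) t)
      rw [← LinearPresheaf.res_comp, ← LinearPresheaf.res_comp,
        SemigroupCategory.whisker_exchange])

/-- The morphism `P ⟶ T(- ⊠ K)` given by a morphism `P ⊛ R ⟶ T` and an element of `R(K)`. -/
noncomputable def dayCurry {P R T : LinearPresheaf k S} (σ : dayConvolution P R ⟶ T) {K : S}
    (r : R.value K) : P ⟶ T.shiftRight K :=
  LinearPresheaf.mkHom (P := P) (Q := T.shiftRight K)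
    (fun A =>
      { toFun := fun p => LinearPresheaf.component σ (A ⊠ K) (dayPure p r)
        map_add' := fun p p' => by
          rw [dayPure_add_left, map_add]
          rfl
        map_smul' := fun c p => by
          rw [dayPure_smul_left, map_smul]
          rfl })
    (fun {A B} f p => by
      change LinearPresheaf.component σ (A ⊠ K) (dayPure _ r) = T.res (f ▷ₛ K) _
      rw [dayPure_res_left, LinearPresheaf.comp_res]
      rfl)

lemma day_hom_ext_left₂ {P Q R T Y : LinearPresheaf k S}
    {σ τ : dayConvolution (dayConvolution (dayConvolution P Q) R) T ⟶ Y}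
    (h : ∀ (H L K M : S) (p : P.value H) (q : Q.value L) (r : R.value K) (t : T.value M),
      LinearPresheaf.component σ (((H ⊠ L) ⊠ K) ⊠ M) (dayPure (dayPure (dayPure p q) r) t) =
        LinearPresheaf.component τ (((H ⊠ L) ⊠ K) ⊠ M) (dayPure (dayPure (dayPure p q) r) t)) :
    σ = τ := by
  apply day_hom_ext
  intro A M x t
  have e : dayCurry σ t = dayCurry τ t := day_hom_ext_left fun H L K p q r => h H L K M p q r t
  exact congrArg (fun ρ => LinearPresheaf.component ρ A x) e

section

variable (P Q R : LinearPresheaf k S)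

/-- For fixed `r`, the morphism `P ⊛ Q ⟶ (P ⊛ (Q ⊛ R))(- ⊠ K)` given by
`p ⊗ q ↦ p ⊗ (q ⊗ r)`, up to the associator of `S`. -/
noncomputable def dayAssocAux {K : S} (r : R.value K) :
    dayConvolution P Q ⟶ (dayConvolution P (dayConvolution Q R)).shiftRight K :=
  dayLift
    { map := fun {H L} p q => (dayConvolution P (dayConvolution Q R)).res (αₛ H L K).hom
        (dayPure p (dayPure q r))
      add_left := fun p p' q => by
        rw [dayPure_add_left, map_add]
        rfl
      smul_left := fun c p q => by
        rw [dayPure_smul_left, map_smul]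
        rfl
      add_right := fun p q q' => by
        rw [dayPure_add_left, dayPure_add_right, map_add]
        rfl
      smul_right := fun c p q => by
        rw [dayPure_smul_left, dayPure_smul_right, map_smul]
        rfl
      res_left := fun {H H' L} g p q => by
        rw [dayPure_res_left, ← LinearPresheaf.res_comp,
          ← SemigroupCategory.associator_naturality_left, LinearPresheaf.res_comp]
        rfl
      res_right := fun {H L L'} g p q => by
        rw [dayPure_res_left, dayPure_res_right, ← LinearPresheaf.res_comp,
          ← SemigroupCategory.associator_naturality_middle, LinearPresheaf.res_comp]
        rfl }

lemma dayAssocAux_pure {H L K : S} (p : P.value H) (q : Q.value L) (r : R.value K) :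
    LinearPresheaf.component (dayAssocAux P Q R r) (H ⊠ L) (dayPure p q) =
      (dayConvolution P (dayConvolution Q R)).res (αₛ H L K).hom (dayPure p (dayPure q r)) :=
  dayLift_pure _ _ _

lemma dayAssocAux_add {K : S} (r r' : R.value K) :
    dayAssocAux P Q R (r + r') = dayAssocAux P Q R r + dayAssocAux P Q R r' := by
  apply day_hom_ext
  intro H L p q
  rw [LinearPresheaf.comp_add]
  simp only [dayAssocAux_pure]
  rw [dayPure_add_right, dayPure_add_right, map_add]
  rfl

lemma dayAssocAux_smul {K : S} (c : k) (r : R.value K) :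
    dayAssocAux P Q R (c • r) = c • dayAssocAux P Q R r := by
  apply day_hom_ext
  intro H L p q
  rw [LinearPresheaf.comp_smul]
  simp only [dayAssocAux_pure]
  rw [dayPure_smul_right, dayPure_smul_right, map_smul]
  rfl

lemma dayAssocAux_res {K K' : S} (g : K ⟶ K') (r : R.value K') :
    dayAssocAux P Q R (R.res g r) = dayAssocAux P Q R r ≫
      (dayConvolution P (dayConvolution Q R)).shiftRightMap g := by
  apply day_hom_ext
  intro H L p q
  rw [LinearPresheaf.comp_comp]
  simp only [dayAssocAux_pure]
  rw [dayPure_res_right, dayPure_res_right, ← LinearPresheaf.res_comp,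
    ← SemigroupCategory.associator_naturality_right, LinearPresheaf.res_comp]
  rfl

/-- The morphism `(P ⊛ Q) ⊛ R ⟶ P ⊛ (Q ⊛ R)`. -/
noncomputable def dayAssocHom :
    dayConvolution (dayConvolution P Q) R ⟶ dayConvolution P (dayConvolution Q R) :=
  dayLift
    { map := fun {A _} x r => LinearPresheaf.component (dayAssocAux P Q R r) A x
      add_left := fun x x' r => map_add _ _ _
      smul_left := fun c x r => map_smul _ _ _
      add_right := fun x r r' => by
        rw [dayAssocAux_add]
        rfl
      smul_right := fun c x r => by
        rw [dayAssocAux_smul]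
        rfl
      res_left := fun g x r => LinearPresheaf.comp_res _ _ _
      res_right := fun {A _ _} g x r =>
        congrArg (fun ρ => LinearPresheaf.component ρ A x) (dayAssocAux_res P Q R g r) }

lemma dayAssocHom_pure {H L K : S} (p : P.value H) (q : Q.value L) (r : R.value K) :
    LinearPresheaf.component (dayAssocHom P Q R) ((H ⊠ L) ⊠ K) (dayPure (dayPure p q) r) =
      (dayConvolution P (dayConvolution Q R)).res (αₛ H L K).hom (dayPure p (dayPure q r)) :=
  (dayLift_pure _ _ _).trans (dayAssocAux_pure P Q R p q r)

/-- For fixed `p`, the morphism `Q ⊛ R ⟶ ((P ⊛ Q) ⊛ R)(H ⊠ -)` given by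
`q ⊗ r ↦ (p ⊗ q) ⊗ r`, up to the associator of `S`. -/
noncomputable def dayAssocInvAux {H : S} (p : P.value H) :
    dayConvolution Q R ⟶ (dayConvolution (dayConvolution P Q) R).shiftLeft H :=
  dayLift
    { map := fun {L K} q r => (dayConvolution (dayConvolution P Q) R).res (αₛ H L K).inv
        (dayPure (dayPure p q) r)
      add_left := fun q q' r => by
        rw [dayPure_add_right, dayPure_add_left, map_add]
        rfl
      smul_left := fun c q r => by
        rw [dayPure_smul_right, dayPure_smul_left, map_smul]
        rfl
      add_right := fun q r r' => by
        rw [dayPure_add_right, map_add]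
        rfl
      smul_right := fun c q r => by
        rw [dayPure_smul_right, map_smul]
        rfl
      res_left := fun {L L' K} g q r => by
        have e : (αₛ H L K).inv ≫ (H ◁ₛ g) ▷ₛ K = H ◁ₛ (g ▷ₛ K) ≫ (αₛ H L' K).inv := by
          rw [Iso.eq_comp_inv, Category.assoc, SemigroupCategory.associator_naturality_middle,
            Iso.inv_hom_id_assoc]
        rw [dayPure_res_right, dayPure_res_left, ← LinearPresheaf.res_comp, e,
          LinearPresheaf.res_comp]
        rfl
      res_right := fun {L K K'} g q r => by
        have e : (αₛ H L K).inv ≫ (H ⊠ L) ◁ₛ g = H ◁ₛ (L ◁ₛ g) ≫ (αₛ H L K').inv := by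
          rw [Iso.eq_comp_inv, Category.assoc, SemigroupCategory.associator_naturality_right,
            Iso.inv_hom_id_assoc]
        rw [dayPure_res_right, ← LinearPresheaf.res_comp, e, LinearPresheaf.res_comp]
        rfl }

lemma dayAssocInvAux_pure {H L K : S} (p : P.value H) (q : Q.value L) (r : R.value K) :
    LinearPresheaf.component (dayAssocInvAux P Q R p) (L ⊠ K) (dayPure q r) =
      (dayConvolution (dayConvolution P Q) R).res (αₛ H L K).inv (dayPure (dayPure p q) r) :=
  dayLift_pure _ _ _

lemma dayAssocInvAux_add {H : S} (p p' : P.value H) :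
    dayAssocInvAux P Q R (p + p') = dayAssocInvAux P Q R p + dayAssocInvAux P Q R p' := by
  apply day_hom_ext
  intro L K q r
  rw [LinearPresheaf.comp_add]
  simp only [dayAssocInvAux_pure]
  rw [dayPure_add_left, dayPure_add_left, map_add]
  rfl

lemma dayAssocInvAux_smul {H : S} (c : k) (p : P.value H) :
    dayAssocInvAux P Q R (c • p) = c • dayAssocInvAux P Q R p := by
  apply day_hom_ext
  intro L K q r
  rw [LinearPresheaf.comp_smul]
  simp only [dayAssocInvAux_pure]
  rw [dayPure_smul_left, dayPure_smul_left, map_smul]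
  rfl

lemma dayAssocInvAux_res {H H' : S} (g : H ⟶ H') (p : P.value H') :
    dayAssocInvAux P Q R (P.res g p) = dayAssocInvAux P Q R p ≫
      (dayConvolution (dayConvolution P Q) R).shiftLeftMap g := by
  apply day_hom_ext
  intro L K q r
  have e : (αₛ H L K).inv ≫ (g ▷ₛ L) ▷ₛ K = g ▷ₛ (L ⊠ K) ≫ (αₛ H' L K).inv := by
    rw [Iso.eq_comp_inv, Category.assoc, SemigroupCategory.associator_naturality_left,
      Iso.inv_hom_id_assoc]
  rw [LinearPresheaf.comp_comp]
  simp only [dayAssocInvAux_pure]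
  rw [dayPure_res_left, dayPure_res_left, ← LinearPresheaf.res_comp, e, LinearPresheaf.res_comp]
  rfl

/-- The morphism `P ⊛ (Q ⊛ R) ⟶ (P ⊛ Q) ⊛ R`. -/
noncomputable def dayAssocInv :
    dayConvolution P (dayConvolution Q R) ⟶ dayConvolution (dayConvolution P Q) R :=
  dayLift
    { map := fun {_ A} p x => LinearPresheaf.component (dayAssocInvAux P Q R p) A x
      add_left := fun p p' x => by
        rw [dayAssocInvAux_add]
        rfl
      smul_left := fun c p x => by
        rw [dayAssocInvAux_smul]
        rfl
      add_right := fun p x x' => map_add _ _ _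
      smul_right := fun c p x => map_smul _ _ _
      res_left := fun {_ _ A} g p x =>
        congrArg (fun ρ => LinearPresheaf.component ρ A x) (dayAssocInvAux_res P Q R g p)
      res_right := fun g p x => LinearPresheaf.comp_res _ _ _ }

lemma dayAssocInv_pure {H L K : S} (p : P.value H) (q : Q.value L) (r : R.value K) :
    LinearPresheaf.component (dayAssocInv P Q R) (H ⊠ (L ⊠ K)) (dayPure p (dayPure q r)) =
      (dayConvolution (dayConvolution P Q) R).res (αₛ H L K).inv (dayPure (dayPure p q) r) :=
  (dayLift_pure _ _ _).trans (dayAssocInvAux_pure P Q R p q r)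

/-- The associator of the Day convolution. -/
noncomputable def dayAssociator :
    dayConvolution (dayConvolution P Q) R ≅ dayConvolution P (dayConvolution Q R) where
  hom := dayAssocHom P Q R
  inv := dayAssocInv P Q R
  hom_inv_id := by
    apply day_hom_ext_left
    intro H L K p q r
    rw [LinearPresheaf.comp_comp, dayAssocHom_pure, LinearPresheaf.comp_res, dayAssocInv_pure,
      ← LinearPresheaf.res_comp, Iso.hom_inv_id, LinearPresheaf.res_id, LinearPresheaf.comp_id]
  inv_hom_id := by
    apply day_hom_ext_right
    intro H L K p q r
    rw [LinearPresheaf.comp_comp, dayAssocInv_pure, LinearPresheaf.comp_res, dayAssocHom_pure,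
      ← LinearPresheaf.res_comp, Iso.inv_hom_id, LinearPresheaf.res_id, LinearPresheaf.comp_id]

end

/-- The presheaf category is a semigroup category under Day convolution. -/
noncomputable instance : SemigroupCategory (LinearPresheaf k S) where
  tensorObj := dayConvolution
  whiskerLeft P _ _ τ := dayWhiskerLeft P τ
  whiskerRight τ R := dayWhiskerRight R τ
  associator := dayAssociator
  whiskerLeft_id P Q := day_hom_ext fun H K p q => by
    rw [dayWhiskerLeft_pure]
    rfl
  whiskerLeft_comp P _ _ _ σ τ := day_hom_ext fun H K p q => by
    simp only [dayWhiskerLeft_pure, LinearPresheaf.comp_comp]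
  id_whiskerRight P Q := day_hom_ext fun H K p q => by
    rw [dayWhiskerRight_pure]
    rfl
  comp_whiskerRight σ τ R := day_hom_ext fun H K p q => by
    simp only [dayWhiskerRight_pure, LinearPresheaf.comp_comp]
  whisker_exchange σ τ := day_hom_ext fun H K p q => by
    simp only [dayWhiskerRight_pure, dayWhiskerLeft_pure, LinearPresheaf.comp_comp]
  associator_naturality_left σ Q R := day_hom_ext_left fun H L K p q r => by
    simp only [LinearPresheaf.comp_comp, dayWhiskerRight_pure]
    simp only [dayAssociator, dayAssocHom_pure, LinearPresheaf.comp_res, dayWhiskerRight_pure]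
  associator_naturality_middle P _ _ σ R := day_hom_ext_left fun H L K p q r => by
    simp only [LinearPresheaf.comp_comp, dayWhiskerRight_pure, dayWhiskerLeft_pure]
    simp only [dayAssociator, dayAssocHom_pure, LinearPresheaf.comp_res, dayWhiskerRight_pure,
      dayWhiskerLeft_pure]
  associator_naturality_right P Q _ _ σ := day_hom_ext_left fun H L K p q r => by
    simp only [LinearPresheaf.comp_comp, dayWhiskerLeft_pure]
    simp only [dayAssociator, dayAssocHom_pure, LinearPresheaf.comp_res, dayWhiskerLeft_pure]
  pentagon P Q R T := day_hom_ext_left₂ fun H L K M p q r t => by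
    simp only [LinearPresheaf.comp_comp, dayWhiskerRight_pure, dayAssociator, dayAssocHom_pure,
      dayPure_res_left, LinearPresheaf.comp_res, dayWhiskerLeft_pure, dayPure_res_right]
    simp only [← LinearPresheaf.res_comp]
    rw [SemigroupCategory.pentagon]

instance : LinearSemigroupCategory k (LinearPresheaf k S) where
  whiskerLeft_add := dayWhiskerLeft_add
  whiskerLeft_smul := dayWhiskerLeft_smul
  add_whiskerRight σ τ R := dayWhiskerRight_add R σ τ
  smul_whiskerRight c σ R := dayWhiskerRight_smul R c σ

end Presheaves

end NonunitalRigidity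

/-! An element `u` of the unit presheaf `I` at `E` is a natural family `u_X : E ⊠ X ⟶ X` with `u_{X
⊠ Y} = u_X ⊠ Y` up to associators. It acts on the left of every object, so `u ⊗ p ↦ P(u_K)(p)` is a
candidate for the left unitor. A right unitor needs maps `H ⊠ E ⟶ H`, and rigidity supplies them.
There is exactly one `leftApp u H : H ⊠ E ⟶ H` whose whiskering by each `K` is `H ◁ u_K` up to the
associator. It exists because the unit and counit of a dual of `H` give a formula for it, and
condition 4 with a zigzag evaluates its whiskerings (`leftApp_whiskerRight`). It is unique because
condition 3 recovers a morphism `f` into `F` from `f ▷ (F' ⊠ F)` (`whiskerRight_injective`). The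
triangle axiom is then precisely the characterization of `leftApp`.

The unitors are invertible because each `X` factors through its own counit: condition 3 writes
`id_X` as a unit followed by a counit, and the counit is an element of `I`. So `p` in `P(X)` has the
preimage `counit ⊗ p`, restricted along the unit. That this is a two-sided inverse rests on
`res_leftApp`: two elements of `I` may be exchanged, which carries an arbitrary `u` past the counit.
For the right unitor, condition 4 identifies the left-handed counterpart of the counit with the left
counit (`leftApp_counit`).

For representables, every pure tensor `a ⊗ b` is a restriction of `id ⊗ id`, so the coend collapses
to `S(-, H ⊠ K)`. Under this identification the evaluation is the counit, through the Yoneda lemma,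
and the coevaluation sends `u` at `E` to `E ⟶ E ⊠ (F' ⊠ F) ⟶ F' ⊠ F`. Both zigzags reduce to
condition 3. -/

namespace NonunitalRigidity

/-! ### Rearrangements of associators. -/

section Semigroup

variable {C : Type u} [Category.{v} C] [SemigroupCategory C]

lemma associator_inv_naturality_left {X₁ X₂ : C} (f : X₁ ⟶ X₂) (Y Z : C) :
    (αₛ X₁ Y Z).inv ≫ (f ▷ₛ Y) ▷ₛ Z = f ▷ₛ (Y ⊠ Z) ≫ (αₛ X₂ Y Z).inv := by
  rw [Iso.inv_comp_eq, ← Category.assoc, Iso.eq_comp_inv,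
    SemigroupCategory.associator_naturality_left]

/-- The form of the pentagon that, in `leftApp_whiskerRight`, brings a counit into the position
required by a zigzag equation. -/
lemma pentagon_inv_hom (W X Y Z : C) :
    (αₛ W (X ⊠ Y) Z).inv ≫ (αₛ W X Y).inv ▷ₛ Z ≫ (αₛ (W ⊠ X) Y Z).hom =
      W ◁ₛ (αₛ X Y Z).hom ≫ (αₛ W X (Y ⊠ Z)).inv := by
  have h := SemigroupCategory.pentagon W X Y Z
  have e : (αₛ W X Y).inv ▷ₛ Z ≫ (αₛ W X Y).hom ▷ₛ Z = 𝟙 _ := by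
    rw [← SemigroupCategory.comp_whiskerRight, Iso.inv_hom_id, SemigroupCategory.id_whiskerRight]
  rw [Iso.inv_comp_eq, ← Category.assoc, Iso.eq_comp_inv, Category.assoc,
    ← h, ← Category.assoc, e, Category.id_comp]

end Semigroup

/-! ### Elements of the unit presheaf and the structure maps of an adjunction. -/

section UnitElements

variable {k : Type w} [Field k] {S : Type u} [SmallCategory S] [Preadditive S] [Linear k S]
  [SemigroupCategory S] [LinearSemigroupCategory k S]

/-- The component `F ⊠ X ⟶ X` of an element of the unit presheaf. -/
def unitApp {F : S} (u : (unitPresheaf k S).value F) (X : S) : F ⊠ X ⟶ X :=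
  NatTrans.app (Subtype.val (p := fun τ => τ ∈ rightModuleTransformations (leftMul k F)
    (RightModuleEndofunctor.identity k S)) u) X

lemma unitApp_naturality {F : S} (u : (unitPresheaf k S).value F) {X Y : S} (g : X ⟶ Y) :
    F ◁ₛ g ≫ unitApp u Y = unitApp u X ≫ g :=
  NatTrans.naturality (Subtype.val (p := fun τ => τ ∈ rightModuleTransformations (leftMul k F)
    (RightModuleEndofunctor.identity k S)) u) g

/-- This is the right module condition: the structure map of `F ⊠ -` is the inverse associator and
that of the identity functor is trivial. -/
lemma unitApp_tensor {F : S} (u : (unitPresheaf k S).value F) (X Y : S) :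
    (αₛ F X Y).inv ≫ unitApp u X ▷ₛ Y = unitApp u (X ⊠ Y) :=
  (Subtype.property (p := fun τ => τ ∈ rightModuleTransformations (leftMul k F)
    (RightModuleEndofunctor.identity k S)) u X Y).trans (Category.comp_id _)

lemma unitApp_ext {F : S} {u u' : (unitPresheaf k S).value F}
    (h : ∀ X, unitApp u X = unitApp u' X) : u = u' :=
  Subtype.ext (NatTrans.ext (funext h))

lemma unitApp_add {F : S} (u u' : (unitPresheaf k S).value F) (X : S) :
    unitApp (u + u') X = unitApp u X + unitApp u' X := rfl

lemma unitApp_smul {F : S} (r : k) (u : (unitPresheaf k S).value F) (X : S) :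
    unitApp (r • u) X = r • unitApp u X := rfl

lemma unitApp_res {F G : S} (g : F ⟶ G) (u : (unitPresheaf k S).value G) (X : S) :
    unitApp ((unitPresheaf k S).res g u) X = g ▷ₛ X ≫ unitApp u X := rfl

namespace SemigroupAdjunction

variable {F F' : S} (A : SemigroupAdjunction k F F')

/-- The component of the left unit. -/
def unitL (X : S) : X ⟶ X ⊠ (F' ⊠ F) := A.ηl.1.app X

/-- The component of the right unit. -/
def unitR (X : S) : X ⟶ (F' ⊠ F) ⊠ X := A.ηr.1.app X

/-- The component of the left counit. -/
def counitL (X : S) : X ⊠ (F ⊠ F') ⟶ X := A.εl.1.app X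

/-- The right counit, as an element of the unit presheaf. -/
def counit : (unitPresheaf k S).value (F ⊠ F') := A.εr

lemma unitL_naturality {X Y : S} (f : X ⟶ Y) :
    f ≫ A.unitL Y = A.unitL X ≫ f ▷ₛ (F' ⊠ F) := A.ηl.1.naturality f

lemma counitL_naturality {X Y : S} (f : X ⟶ Y) :
    f ▷ₛ (F ⊠ F') ≫ A.counitL Y = A.counitL X ≫ f := A.εl.1.naturality f

lemma unitL_tensor (X Y : S) :
    A.unitL (X ⊠ Y) ≫ (αₛ X Y (F' ⊠ F)).hom = X ◁ₛ A.unitL Y :=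
  (A.ηl.2 X Y).symm.trans (Category.id_comp _)

lemma counitL_tensor (X Y : S) :
    (αₛ X Y (F ⊠ F')).hom ≫ X ◁ₛ A.counitL Y = A.counitL (X ⊠ Y) :=
  (A.εl.2 X Y).trans (Category.comp_id _)

lemma unitL_whiskerRight (H K : S) :
    A.unitL H ▷ₛ K = H ◁ₛ A.unitR K ≫ (αₛ H (F' ⊠ F) K).inv := (A.unit_compat H K).symm

lemma counitL_whiskerRight (H K : S) :
    A.counitL H ▷ₛ K = (αₛ H (F ⊠ F') K).hom ≫ H ◁ₛ unitApp A.counit K := A.counit_compat H K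

lemma unitL_counit : A.unitL F ≫ (αₛ F F' F).inv ≫ unitApp A.counit F = 𝟙 F := A.zigzag

lemma unitR_counitL : A.unitR F' ≫ (αₛ F' F F').hom ≫ A.counitL F' = 𝟙 F' := A.zigzag'

lemma whiskerLeft_unitR_counit (X : S) :
    F ◁ₛ A.unitR X ≫ F ◁ₛ (αₛ F' F X).hom ≫ (αₛ F F' (F ⊠ X)).inv ≫
      unitApp A.counit (F ⊠ X) = 𝟙 (F ⊠ X) := A.right_triangle₁ X

/-- By condition 3, `f` equals `f` followed by `unitL F` and the counit. Naturality of the left unit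
moves `f` past it, after which `f` occurs only as `f ▷ (F' ⊠ F)`. -/
lemma whiskerRight_injective (A : SemigroupAdjunction k F F') {X : S} {f g : X ⟶ F}
    (h : f ▷ₛ (F' ⊠ F) = g ▷ₛ (F' ⊠ F)) : f = g := by
  rw [← Category.comp_id f, ← Category.comp_id g, ← A.unitL_counit, ← Category.assoc f,
    ← Category.assoc g, A.unitL_naturality, A.unitL_naturality, h]

/-- The left-handed counterpart `F ⊠ E ⟶ F` of an element of the unit presheaf at `E`. -/
def leftApp {E : S} (u : (unitPresheaf k S).value E) : F ⊠ E ⟶ F :=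
  A.unitL (F ⊠ E) ≫ (αₛ F E (F' ⊠ F)).hom ≫ F ◁ₛ unitApp u (F' ⊠ F) ≫ (αₛ F F' F).inv ≫
    unitApp A.counit F

/-- Condition 4 turns a left unit whiskered by `K` into a right unit applied to `K`. There `u` can
slide past it by naturality, and the unit and counit that remain cancel by a zigzag of `F ⊠ -` and
`F' ⊠ -`. -/
lemma leftApp_whiskerRight {E : S} (u : (unitPresheaf k S).value E) (K : S) :
    A.leftApp u ▷ₛ K = (αₛ F E K).hom ≫ F ◁ₛ unitApp u K := by
  unfold leftApp
  simp only [SemigroupCategory.comp_whiskerRight, unitL_whiskerRight, Category.assoc]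
  have h₁ : unitApp A.counit F ▷ₛ K =
      (αₛ (F ⊠ F') F K).hom ≫ unitApp A.counit (F ⊠ K) := by
    rw [← unitApp_tensor, Iso.hom_inv_id_assoc]
  have h₂ : (F ◁ₛ unitApp u (F' ⊠ F)) ▷ₛ K = (αₛ F (E ⊠ (F' ⊠ F)) K).hom ≫
      F ◁ₛ (unitApp u (F' ⊠ F) ▷ₛ K) ≫ (αₛ F (F' ⊠ F) K).inv := by
    rw [← Category.assoc, Iso.eq_comp_inv, SemigroupCategory.associator_naturality_middle]
  -- The pentagon for `F`, `E`, `F' ⊠ F`, `K`, solved so that the right unit of `K` ends up under `F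
  -- ⊠ (E ⊠ -)`.
  have h₃ : (αₛ (F ⊠ E) (F' ⊠ F) K).inv ≫ (αₛ F E (F' ⊠ F)).hom ▷ₛ K ≫
      (αₛ F (E ⊠ (F' ⊠ F)) K).hom =
        (αₛ F E ((F' ⊠ F) ⊠ K)).hom ≫ F ◁ₛ (αₛ E (F' ⊠ F) K).inv := by
    have e : F ◁ₛ (αₛ E (F' ⊠ F) K).hom ≫ F ◁ₛ (αₛ E (F' ⊠ F) K).inv = 𝟙 _ := by
      rw [← SemigroupCategory.whiskerLeft_comp, Iso.hom_inv_id, SemigroupCategory.whiskerLeft_id]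
    have h := SemigroupCategory.pentagon F E (F' ⊠ F) K
    rw [Iso.inv_comp_eq, ← Category.assoc _ (αₛ F E ((F' ⊠ F) ⊠ K)).hom, ← h, Category.assoc,
      Category.assoc, e, Category.comp_id]
  calc _ = (F ⊠ E) ◁ₛ A.unitR K ≫ ((αₛ (F ⊠ E) (F' ⊠ F) K).inv ≫ (αₛ F E (F' ⊠ F)).hom ▷ₛ K ≫
        (αₛ F (E ⊠ (F' ⊠ F)) K).hom) ≫ F ◁ₛ (unitApp u (F' ⊠ F) ▷ₛ K) ≫
        ((αₛ F (F' ⊠ F) K).inv ≫ (αₛ F F' F).inv ▷ₛ K ≫ (αₛ (F ⊠ F') F K).hom) ≫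
          unitApp A.counit (F ⊠ K) := by
        simp only [h₁, h₂, Category.assoc]
    _ = ((F ⊠ E) ◁ₛ A.unitR K ≫ (αₛ F E ((F' ⊠ F) ⊠ K)).hom) ≫
        (F ◁ₛ (αₛ E (F' ⊠ F) K).inv ≫ F ◁ₛ (unitApp u (F' ⊠ F) ▷ₛ K)) ≫
          F ◁ₛ (αₛ F' F K).hom ≫ (αₛ F F' (F ⊠ K)).inv ≫ unitApp A.counit (F ⊠ K) := by
        rw [h₃, pentagon_inv_hom]
        simp only [Category.assoc]
    -- Up to an associator, `unitApp u (F' ⊠ F) ▷ K` is the component of `u` at `(F' ⊠ F) ⊠ K`;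
    -- naturality of `u` along `unitR K` then replaces it by the component at `K`.
    _ = (αₛ F E K).hom ≫ F ◁ₛ unitApp u K ≫ F ◁ₛ A.unitR K ≫
          F ◁ₛ (αₛ F' F K).hom ≫ (αₛ F F' (F ⊠ K)).inv ≫ unitApp A.counit (F ⊠ K) := by
        rw [SemigroupCategory.associator_naturality_right, ← SemigroupCategory.whiskerLeft_comp,
          unitApp_tensor, Category.assoc, ← Category.assoc (F ◁ₛ (E ◁ₛ _)),
          ← SemigroupCategory.whiskerLeft_comp, unitApp_naturality,
          SemigroupCategory.whiskerLeft_comp, Category.assoc]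
    _ = _ := by rw [whiskerLeft_unitR_counit, Category.comp_id]

end SemigroupAdjunction

end UnitElements

/-! ### Left-handed counterparts over a rigid semigroup category, and commutativity of the unit
presheaf. -/

section Rigid

variable {k : Type w} [Field k] {S : Type u} [SmallCategory S] [Preadditive S] [Linear k S]
  [SemigroupCategory S] [LinearSemigroupCategory k S]

namespace IsRigidSemigroupCategory

variable (hS : IsRigidSemigroupCategory k S)

/-- A chosen right dual. -/
noncomputable def rightDual (F : S) : S := (hS F).1.choose

/-- The adjunction between an object and its chosen right dual. -/
noncomputable def rightAdjunction (F : S) : SemigroupAdjunction k F (hS.rightDual F) :=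
  (hS F).1.choose_spec.some

/-- A chosen left dual. -/
noncomputable def leftDual (F : S) : S := (hS F).2.choose

/-- The adjunction between the chosen left dual of an object and that object. -/
noncomputable def leftAdjunction (F : S) : SemigroupAdjunction k (hS.leftDual F) F :=
  (hS F).2.choose_spec.some

lemma whiskerRight_injective (hS : IsRigidSemigroupCategory k S) {X F : S} {f g : X ⟶ F}
    (h : ∀ K : S, f ▷ₛ K = g ▷ₛ K) : f = g :=
  (hS.rightAdjunction F).whiskerRight_injective (h _)

/-- The left-handed counterpart `H ⊠ E ⟶ H` of an element of the unit presheaf at `E`. -/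
noncomputable def leftApp {E : S} (u : (unitPresheaf k S).value E) (H : S) : H ⊠ E ⟶ H :=
  (hS.rightAdjunction H).leftApp u

lemma leftApp_whiskerRight {E : S} (u : (unitPresheaf k S).value E) (H K : S) :
    hS.leftApp u H ▷ₛ K = (αₛ H E K).hom ≫ H ◁ₛ unitApp u K :=
  (hS.rightAdjunction H).leftApp_whiskerRight u K

/-- The left-handed counterpart of an element of the unit presheaf is characterized by its
whiskerings. -/
lemma eq_leftApp {E H : S} (u : (unitPresheaf k S).value E) {f : H ⊠ E ⟶ H}
    (h : ∀ K, f ▷ₛ K = (αₛ H E K).hom ≫ H ◁ₛ unitApp u K) : f = hS.leftApp u H :=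
  hS.whiskerRight_injective fun K => (h K).trans (hS.leftApp_whiskerRight u H K).symm

/-- Here and in the next three lemmas the chosen dual plays no role: whiskering by `K` replaces
`leftApp u H` by `H ◁ u_K`, for which the claim is immediate. In this case it is the interchange
law. -/
lemma leftApp_naturality {E : S} (u : (unitPresheaf k S).value E) {H H' : S} (g : H ⟶ H') :
    g ▷ₛ E ≫ hS.leftApp u H' = hS.leftApp u H ≫ g :=
  hS.whiskerRight_injective fun K => by
    rw [SemigroupCategory.comp_whiskerRight, SemigroupCategory.comp_whiskerRight,
      leftApp_whiskerRight, leftApp_whiskerRight, ← Category.assoc,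
      SemigroupCategory.associator_naturality_left, Category.assoc, Category.assoc,
      SemigroupCategory.whisker_exchange]

lemma leftApp_add {E : S} (u u' : (unitPresheaf k S).value E) (H : S) :
    hS.leftApp (u + u') H = hS.leftApp u H + hS.leftApp u' H :=
  hS.whiskerRight_injective fun K => by
    rw [LinearSemigroupCategory.add_whiskerRight k]
    simp only [leftApp_whiskerRight, unitApp_add, LinearSemigroupCategory.whiskerLeft_add k,
      Preadditive.comp_add]

lemma leftApp_smul {E : S} (r : k) (u : (unitPresheaf k S).value E) (H : S) :
    hS.leftApp (r • u) H = r • hS.leftApp u H :=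
  hS.whiskerRight_injective fun K => by
    rw [LinearSemigroupCategory.smul_whiskerRight]
    simp only [leftApp_whiskerRight, unitApp_smul, LinearSemigroupCategory.whiskerLeft_smul,
      Linear.comp_smul]

lemma leftApp_res {E E' : S} (g : E ⟶ E') (u : (unitPresheaf k S).value E') (H : S) :
    hS.leftApp ((unitPresheaf k S).res g u) H = H ◁ₛ g ≫ hS.leftApp u H :=
  hS.whiskerRight_injective fun K => by
    rw [SemigroupCategory.comp_whiskerRight, leftApp_whiskerRight, leftApp_whiskerRight,
      unitApp_res, SemigroupCategory.whiskerLeft_comp, ← Category.assoc, ← Category.assoc,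
      SemigroupCategory.associator_naturality_middle]

/-- The counit half of condition 4 says that the left counit has the whiskerings which characterize
`leftApp` of the right counit. The adjunction need not be the one chosen for `H`. -/
lemma leftApp_counit {F F' : S} (A : SemigroupAdjunction k F F') (H : S) :
    hS.leftApp A.counit H = A.counitL H :=
  (hS.eq_leftApp _ (A.counitL_whiskerRight H)).symm

/-- The unit presheaf is commutative. -/
lemma res_leftApp {E F : S} (u : (unitPresheaf k S).value F) (v : (unitPresheaf k S).value E) :
    (unitPresheaf k S).res (hS.leftApp u E) v = (unitPresheaf k S).res (unitApp v F) u :=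
  unitApp_ext fun Y => by
    -- Both sides apply `u` and `v`, in opposite orders. The exchange is naturality of `v` along the
    -- morphism `unitApp u Y`, followed by the module property of `v`.
    rw [unitApp_res, unitApp_res, leftApp_whiskerRight, Category.assoc, unitApp_naturality,
      ← unitApp_tensor, Category.assoc, Iso.hom_inv_id_assoc]

end IsRigidSemigroupCategory

end Rigid

/-! ### Pointwise detection of isomorphisms of presheaves. -/

section Presheaves

variable {k : Type w} [Field k] {S : Type u} [SmallCategory S] [Preadditive S] [Linear k S]

/-- Pointwise inverses of a natural map are natural. The inverses of the unitors are built from a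
dual chosen separately for each object, so this spares a direct check of their naturality. -/
lemma LinearPresheaf.isIso_of_bijective {P Q : LinearPresheaf k S} (τ : P ⟶ Q)
    (h : ∀ X : S, Function.Bijective (component τ X)) : IsIso τ := by
  let e (X : S) := LinearEquiv.ofBijective (component τ X) (h X)
  have he (X : S) (p : P.value X) : (e X).symm (component τ X p) = p := (e X).symm_apply_apply p
  have he' (X : S) (q : Q.value X) : component τ X ((e X).symm q) = q := (e X).apply_symm_apply q
  refine ⟨mkHom (fun X => ((e X).symm : Q.value X →ₗ[k] P.value X)) (fun {X Y} f q => ?_), ?_, ?_⟩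
  · apply (h X).1
    change component τ X ((e X).symm _) = component τ X (P.res f ((e Y).symm q))
    rw [he', comp_res, he']
  · exact ext_comp fun X p => he X p
  · exact ext_comp fun X q => he' X q

end Presheaves

/-! ### The unitors and the triangle axiom. -/

section Unitors

variable {k : Type w} [Field k] {S : Type u} [SmallCategory S] [Preadditive S] [Linear k S]
  [SemigroupCategory S] [LinearSemigroupCategory k S]

variable (P : LinearPresheaf k S)

/-- The left unit morphism, `u ⊗ p ↦ P(u)(p)`. -/
noncomputable def dayLeftUnitorHom : dayConvolution (unitPresheaf k S) P ⟶ P :=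
  dayLift
    { map := fun {_ K} u p => P.res (unitApp u K) p
      add_left := fun u u' p => by rw [unitApp_add, LinearPresheaf.res_add]
      smul_left := fun r u p => by rw [unitApp_smul, LinearPresheaf.res_smul]
      add_right := fun u p p' => map_add _ _ _
      smul_right := fun r u p => map_smul _ _ _
      res_left := fun g u p => by rw [unitApp_res, LinearPresheaf.res_comp]
      res_right := fun g u p => by
        rw [← LinearPresheaf.res_comp, ← LinearPresheaf.res_comp, unitApp_naturality] }

lemma dayLeftUnitorHom_pure {F K : S} (u : (unitPresheaf k S).value F) (p : P.value K) :
    LinearPresheaf.component (dayLeftUnitorHom P) (F ⊠ K) (dayPure u p) =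
      P.res (unitApp u K) p := dayLift_pure _ _ _

variable (hS : IsRigidSemigroupCategory k S)

/-- The right unit morphism, `p ⊗ u ↦ P(u)(p)`. -/
noncomputable def dayRightUnitorHom : dayConvolution P (unitPresheaf k S) ⟶ P :=
  dayLift
    { map := fun {H _} p u => P.res (hS.leftApp u H) p
      add_left := fun p p' u => map_add _ _ _
      smul_left := fun r p u => map_smul _ _ _
      add_right := fun p u u' => by rw [hS.leftApp_add, LinearPresheaf.res_add]
      smul_right := fun r p u => by rw [hS.leftApp_smul, LinearPresheaf.res_smul]
      res_left := fun g p u => by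
        rw [← LinearPresheaf.res_comp, ← LinearPresheaf.res_comp, hS.leftApp_naturality]
      res_right := fun g p u => by rw [hS.leftApp_res, LinearPresheaf.res_comp] }

lemma dayRightUnitorHom_pure {H E : S} (p : P.value H) (u : (unitPresheaf k S).value E) :
    LinearPresheaf.component (dayRightUnitorHom P hS) (H ⊠ E) (dayPure p u) =
      P.res (hS.leftApp u H) p := dayLift_pure _ _ _

lemma dayLeftUnitorHom_bijective (hS : IsRigidSemigroupCategory k S) (X : S) :
    Function.Bijective (LinearPresheaf.component (dayLeftUnitorHom P) X) := by
  let A := hS.rightAdjunction X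
  -- The candidate inverse: by condition 3 the morphism `X ⟶ (X ⊠ X') ⊠ X` used here, with `X'` the
  -- dual, is split by the counit at `X`.
  let s : P.value X →ₗ[k] (dayConvolution (unitPresheaf k S) P).value X :=
    { toFun := fun p => (dayConvolution (unitPresheaf k S) P).res
        (A.unitL X ≫ (αₛ _ _ _).inv) (dayPure A.counit p)
      map_add' := fun p p' => by rw [dayPure_add_right, map_add]
      map_smul' := fun r p => by rw [dayPure_smul_right, map_smul]; rfl }
  have h₁ : s ∘ₗ LinearPresheaf.component (dayLeftUnitorHom P) X = LinearMap.id := by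
    apply day_linearMap_ext
    intro F K f u p
    change (dayConvolution (unitPresheaf k S) P).res (A.unitL X ≫ (αₛ _ _ _).inv)
      (dayPure A.counit (LinearPresheaf.component (dayLeftUnitorHom P) X _)) = _
    rw [LinearPresheaf.comp_res, dayLeftUnitorHom_pure, ← LinearPresheaf.res_comp,
      dayPure_res_right, ← LinearPresheaf.res_comp, LinearMap.id_apply]
    -- Rewrites the action of `u` on the second tensor factor as an action on the first, where the
    -- coend relation lets it reach the counit.
    have e : (X ⊠ hS.rightDual X) ◁ₛ unitApp u K =
        (αₛ _ _ _).inv ≫ hS.leftApp u (X ⊠ hS.rightDual X) ▷ₛ K := by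
      rw [hS.leftApp_whiskerRight, Iso.inv_hom_id_assoc]
    -- By `res_leftApp`, the counit restricted along `leftApp u` is `u` restricted along the counit.
    -- Now `u` is the tensor factor again, and the counit acts on `F ⊠ K`; naturality moves it in
    -- front of `f`, next to the unit.
    rw [SemigroupCategory.whiskerLeft_comp, e, ← Category.assoc, ← Category.assoc,
      LinearPresheaf.res_comp _ _ (hS.leftApp u _ ▷ₛ K), ← dayPure_res_left, hS.res_leftApp,
      dayPure_res_left, ← LinearPresheaf.res_comp, Category.assoc, Category.assoc,
      unitApp_tensor, unitApp_naturality, ← Category.assoc]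
    congr 2
    simpa only [Category.assoc, Category.id_comp] using congrArg (· ≫ f) A.unitL_counit
  have h₂ (p) : LinearPresheaf.component (dayLeftUnitorHom P) X (s p) = p := by
    change LinearPresheaf.component (dayLeftUnitorHom P) X
      ((dayConvolution (unitPresheaf k S) P).res _ (dayPure A.counit p)) = p
    rw [LinearPresheaf.comp_res, dayLeftUnitorHom_pure, ← LinearPresheaf.res_comp, Category.assoc,
      A.unitL_counit, LinearPresheaf.res_id]
  exact ⟨Function.LeftInverse.injective (g := s) (LinearMap.congr_fun h₁),
    Function.RightInverse.surjective (g := s) h₂⟩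

lemma dayRightUnitorHom_bijective (X : S) :
    Function.Bijective (LinearPresheaf.component (dayRightUnitorHom P hS) X) := by
  let A := hS.leftAdjunction X
  -- The mirror image uses the left dual `'X`: the right unit gives `X ⟶ X ⊠ ('X ⊠ X)`, split by the
  -- left counit through the second equation of condition 3.
  let s : P.value X →ₗ[k] (dayConvolution P (unitPresheaf k S)).value X :=
    { toFun := fun p => (dayConvolution P (unitPresheaf k S)).res
        (A.unitR X ≫ (αₛ _ _ _).hom) (dayPure p A.counit)
      map_add' := fun p p' => by rw [dayPure_add_left, map_add]
      map_smul' := fun r p => by rw [dayPure_smul_left, map_smul]; rfl }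
  have h₁ : s ∘ₗ LinearPresheaf.component (dayRightUnitorHom P hS) X = LinearMap.id := by
    apply day_linearMap_ext
    intro H E f p u
    change (dayConvolution P (unitPresheaf k S)).res (A.unitR X ≫ (αₛ _ _ _).hom)
      (dayPure (LinearPresheaf.component (dayRightUnitorHom P hS) X _) A.counit) = _
    -- Again `u` crosses to the other factor by `leftApp_whiskerRight` and is exchanged with the
    -- counit by `res_leftApp`, this time read backwards; `leftApp_counit` then makes the left
    -- counit appear.
    rw [LinearPresheaf.comp_res, dayRightUnitorHom_pure, ← LinearPresheaf.res_comp,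
      dayPure_res_left, ← LinearPresheaf.res_comp, LinearMap.id_apply,
      SemigroupCategory.comp_whiskerRight, hS.leftApp_whiskerRight, ← Category.assoc,
      ← Category.assoc, LinearPresheaf.res_comp _ _ (H ◁ₛ unitApp u _), ← dayPure_res_right,
      ← hS.res_leftApp, dayPure_res_right, ← LinearPresheaf.res_comp, hS.leftApp_counit,
      Category.assoc, Category.assoc, A.counitL_tensor, A.counitL_naturality, ← Category.assoc]
    congr 2
    simpa only [Category.assoc, Category.id_comp] using congrArg (· ≫ f) A.unitR_counitL
  have h₂ (p) : LinearPresheaf.component (dayRightUnitorHom P hS) X (s p) = p := by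
    change LinearPresheaf.component (dayRightUnitorHom P hS) X
      ((dayConvolution P (unitPresheaf k S)).res _ (dayPure p A.counit)) = p
    rw [LinearPresheaf.comp_res, dayRightUnitorHom_pure, ← LinearPresheaf.res_comp,
      hS.leftApp_counit, Category.assoc, A.unitR_counitL, LinearPresheaf.res_id]
  exact ⟨Function.LeftInverse.injective (g := s) (LinearMap.congr_fun h₁),
    Function.RightInverse.surjective (g := s) h₂⟩

/-- The left unitor of the Day convolution. -/
noncomputable def dayLeftUnitor : dayConvolution (unitPresheaf k S) P ≅ P :=
  haveI := LinearPresheaf.isIso_of_bijective _ (dayLeftUnitorHom_bijective P hS)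
  asIso (dayLeftUnitorHom P)

/-- The right unitor of the Day convolution. -/
noncomputable def dayRightUnitor : dayConvolution P (unitPresheaf k S) ≅ P :=
  haveI := LinearPresheaf.isIso_of_bijective _ (dayRightUnitorHom_bijective P hS)
  asIso (dayRightUnitorHom P hS)

lemma dayLeftUnitor_pure {F K : S} (u : (unitPresheaf k S).value F) (p : P.value K) :
    LinearPresheaf.component (dayLeftUnitor P hS).hom (F ⊠ K) (dayPure u p) =
      P.res (unitApp u K) p := dayLeftUnitorHom_pure P u p

lemma dayRightUnitor_pure {H E : S} (p : P.value H) (u : (unitPresheaf k S).value E) :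
    LinearPresheaf.component (dayRightUnitor P hS).hom (H ⊠ E) (dayPure p u) =
      P.res (hS.leftApp u H) p := dayRightUnitorHom_pure P hS p u

/-- The unit structure of the Day convolution on presheaves on a rigid semigroup category. -/
noncomputable def dayUnitStructure : UnitStructure (unitPresheaf k S) where
  leftUnitor P := dayLeftUnitor P hS
  rightUnitor P := dayRightUnitor P hS
  leftUnitor_naturality {P Q} σ :=
    show dayWhiskerLeft _ σ ≫ (dayLeftUnitor Q hS).hom = (dayLeftUnitor P hS).hom ≫ σ from
    day_hom_ext fun H K u p => by
      rw [LinearPresheaf.comp_comp, LinearPresheaf.comp_comp, dayWhiskerLeft_pure,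
        dayLeftUnitor_pure, dayLeftUnitor_pure, LinearPresheaf.comp_res]
  rightUnitor_naturality {P Q} σ :=
    show dayWhiskerRight _ σ ≫ (dayRightUnitor Q hS).hom = (dayRightUnitor P hS).hom ≫ σ from
    day_hom_ext fun H K p u => by
      rw [LinearPresheaf.comp_comp, LinearPresheaf.comp_comp, dayWhiskerRight_pure,
        dayRightUnitor_pure, dayRightUnitor_pure, LinearPresheaf.comp_res]
  triangle P Q :=
    show dayAssocHom P _ Q ≫ dayWhiskerLeft P (dayLeftUnitor Q hS).hom =
      dayWhiskerRight Q (dayRightUnitor P hS).hom from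
    day_hom_ext_left fun H L K p u q => by
      -- On `(p ⊗ u) ⊗ q` both sides restrict `p ⊗ q`, along the two morphisms that
      -- `leftApp_whiskerRight` identifies.
      rw [LinearPresheaf.comp_comp, dayAssocHom_pure, LinearPresheaf.comp_res,
        dayWhiskerLeft_pure, dayWhiskerRight_pure, dayLeftUnitor_pure, dayRightUnitor_pure,
        dayPure_res_right, dayPure_res_left, hS.leftApp_whiskerRight, LinearPresheaf.res_comp]

end Unitors

/-! ### The Yoneda embedding as a semigroup functor, and the duals of representables. -/

section Yoneda

variable {k : Type w} [Field k] {S : Type u} [SmallCategory S] [Preadditive S] [Linear k S]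

/-- A morphism, as an element of a representable presheaf. -/
def toYoneda {X F : S} (a : X ⟶ F) : ((yonedaEmbedding k S).obj F).value X := a

/-- An element of a representable presheaf, as a morphism. -/
def ofYoneda {X F : S} (a : ((yonedaEmbedding k S).obj F).value X) : X ⟶ F := a

lemma ofYoneda_toYoneda {X F : S} (a : X ⟶ F) : ofYoneda (toYoneda (k := k) a) = a := rfl

lemma toYoneda_ofYoneda {X F : S} (a : ((yonedaEmbedding k S).obj F).value X) :
    toYoneda (ofYoneda a) = a := rfl

lemma ofYoneda_add {X F : S} (a b : ((yonedaEmbedding k S).obj F).value X) :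
    ofYoneda (a + b) = ofYoneda a + ofYoneda b := rfl

lemma ofYoneda_smul {X F : S} (r : k) (a : ((yonedaEmbedding k S).obj F).value X) :
    ofYoneda (r • a) = r • ofYoneda a := rfl

lemma toYoneda_add {X F : S} (a b : X ⟶ F) :
    toYoneda (k := k) (a + b) = toYoneda a + toYoneda b := rfl

lemma toYoneda_smul {X F : S} (r : k) (a : X ⟶ F) :
    toYoneda (k := k) (r • a) = r • toYoneda a := rfl

lemma ofYoneda_res {F X Y : S} (f : X ⟶ Y) (a : ((yonedaEmbedding k S).obj F).value Y) :
    ofYoneda (((yonedaEmbedding k S).obj F).res f a) = f ≫ ofYoneda a := rfl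

lemma yoneda_res {F X Y : S} (f : X ⟶ Y) (a : Y ⟶ F) :
    ((yonedaEmbedding k S).obj F).res f (toYoneda a) = toYoneda (f ≫ a) := rfl

lemma yoneda_map_component {F G : S} (f : F ⟶ G) {X : S} (a : X ⟶ F) :
    LinearPresheaf.component ((yonedaEmbedding k S).map f) X (toYoneda a) =
      toYoneda (a ≫ f) := rfl

lemma yoneda_hom_ext {F : S} {P : LinearPresheaf k S} {σ τ : (yonedaEmbedding k S).obj F ⟶ P}
    (h : ∀ (X : S) (a : X ⟶ F), LinearPresheaf.component σ X (toYoneda a) =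
      LinearPresheaf.component τ X (toYoneda a)) : σ = τ :=
  LinearPresheaf.ext_comp h

/-- The morphism from a representable presheaf given by an element. -/
def yonedaLift {P : LinearPresheaf k S} {F : S} (p : P.value F) :
    (yonedaEmbedding k S).obj F ⟶ P :=
  LinearPresheaf.mkHom (P := (yonedaEmbedding k S).obj F) (Q := P)
    (fun X =>
      { toFun := fun f => P.res (ofYoneda f) p
        map_add' := fun f g => by rw [ofYoneda_add, P.res_add]
        map_smul' := fun r f => by rw [ofYoneda_smul, P.res_smul]; rfl })
    (fun f g => P.res_comp f (ofYoneda g) p)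

lemma yonedaLift_component {P : LinearPresheaf k S} {F X : S} (p : P.value F) (f : X ⟶ F) :
    LinearPresheaf.component (yonedaLift p) X (toYoneda f) = P.res f p := rfl

instance yonedaEmbedding_faithful : (yonedaEmbedding k S).Faithful where
  map_injective {X Y f g} h := by
    have e := congrArg (fun τ => ofYoneda (LinearPresheaf.component τ X (toYoneda (𝟙 X)))) h
    simpa only [yoneda_map_component, Category.id_comp, ofYoneda_toYoneda] using e

instance yonedaEmbedding_full : (yonedaEmbedding k S).Full where
  map_surjective {X _} τ := ⟨ofYoneda (LinearPresheaf.component τ X (toYoneda (𝟙 X))),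
    yoneda_hom_ext fun Z a => by
      rw [yoneda_map_component, ← yoneda_res, toYoneda_ofYoneda, ← LinearPresheaf.comp_res,
        yoneda_res, Category.comp_id]⟩

variable [SemigroupCategory S]

lemma day_yoneda_hom_ext {H K : S} {R : LinearPresheaf k S}
    {σ τ : dayConvolution ((yonedaEmbedding k S).obj H) ((yonedaEmbedding k S).obj K) ⟶ R}
    (h : ∀ (A B : S) (a : A ⟶ H) (b : B ⟶ K),
      LinearPresheaf.component σ (A ⊠ B) (dayPure (toYoneda a) (toYoneda b)) =
        LinearPresheaf.component τ (A ⊠ B) (dayPure (toYoneda a) (toYoneda b))) : σ = τ :=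
  day_hom_ext h

variable (k)

/-- The element `id ⊗ id` of `(S(-, H) ⊛ S(-, K))(H ⊠ K)`. -/
noncomputable def yonedaPure (H K : S) :
    (dayConvolution ((yonedaEmbedding k S).obj H) ((yonedaEmbedding k S).obj K)).value (H ⊠ K) :=
  dayPure (toYoneda (𝟙 H)) (toYoneda (𝟙 K))

/-- The co-Yoneda collapse of the coend: `a` and `b` are restrictions of identities, and the coend
relation moves them into the morphism factor. Hence `id ⊗ id` generates the convolution of two
representables. -/
lemma dayPure_eq_res_yonedaPure {H K A B : S} (a : A ⟶ H) (b : B ⟶ K) :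
    dayPure (toYoneda a) (toYoneda b) =
      (dayConvolution ((yonedaEmbedding k S).obj H) ((yonedaEmbedding k S).obj K)).res
        (a ▷ₛ B ≫ H ◁ₛ b) (yonedaPure k H K) := by
  unfold yonedaPure
  rw [LinearPresheaf.res_comp, ← dayPure_res_right, ← dayPure_res_left, yoneda_res, yoneda_res,
    Category.comp_id, Category.comp_id]

variable [LinearSemigroupCategory k S]

/-- The morphism `S(-, H) ⊛ S(-, K) ⟶ S(-, H ⊠ K)`, `a ⊗ b ↦ a ⊠ b`. -/
noncomputable def yonedaTensorHom (H K : S) :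
    dayConvolution ((yonedaEmbedding k S).obj H) ((yonedaEmbedding k S).obj K) ⟶
      (yonedaEmbedding k S).obj (H ⊠ K) :=
  dayLift
    { map := fun {_ B} a b => toYoneda (ofYoneda a ▷ₛ B ≫ H ◁ₛ ofYoneda b)
      add_left := fun a a' b => by
        rw [ofYoneda_add, LinearSemigroupCategory.add_whiskerRight k, Preadditive.add_comp,
          toYoneda_add]
      smul_left := fun r a b => by
        rw [ofYoneda_smul, LinearSemigroupCategory.smul_whiskerRight, Linear.smul_comp,
          toYoneda_smul]
      add_right := fun a b b' => by
        rw [ofYoneda_add, LinearSemigroupCategory.whiskerLeft_add k, Preadditive.comp_add,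
          toYoneda_add]
      smul_right := fun r a b => by
        rw [ofYoneda_smul, LinearSemigroupCategory.whiskerLeft_smul, Linear.comp_smul,
          toYoneda_smul]
      res_left := fun g a b => by
        rw [ofYoneda_res, SemigroupCategory.comp_whiskerRight, Category.assoc, yoneda_res]
      res_right := fun {A B B'} g a b => by
        rw [ofYoneda_res, SemigroupCategory.whiskerLeft_comp, ← Category.assoc,
          ← SemigroupCategory.whisker_exchange, Category.assoc, yoneda_res] }

lemma yonedaTensorHom_pure {H K A B : S} (a : A ⟶ H) (b : B ⟶ K) :
    LinearPresheaf.component (yonedaTensorHom k H K) (A ⊠ B)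
      (dayPure (toYoneda a) (toYoneda b)) = toYoneda (a ▷ₛ B ≫ H ◁ₛ b) := dayLift_pure _ _ _

/-- The isomorphism `S(-, H) ⊛ S(-, K) ≅ S(-, H ⊠ K)`, `a ⊗ b ↦ a ⊠ b`. -/
noncomputable def yonedaTensorIso (H K : S) :
    dayConvolution ((yonedaEmbedding k S).obj H) ((yonedaEmbedding k S).obj K) ≅
      (yonedaEmbedding k S).obj (H ⊠ K) where
  hom := yonedaTensorHom k H K
  inv := yonedaLift (yonedaPure k H K)
  hom_inv_id := day_yoneda_hom_ext fun A B a b => by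
    rw [LinearPresheaf.comp_comp, yonedaTensorHom_pure, yonedaLift_component,
      ← dayPure_eq_res_yonedaPure, LinearPresheaf.comp_id]
  inv_hom_id := yoneda_hom_ext fun X f => by
    rw [LinearPresheaf.comp_comp, yonedaLift_component, LinearPresheaf.comp_res, yonedaPure,
      yonedaTensorHom_pure, SemigroupCategory.id_whiskerRight,
      SemigroupCategory.whiskerLeft_id, Category.comp_id, yoneda_res, Category.comp_id,
      LinearPresheaf.comp_id]

variable (S) in
/-- The Yoneda embedding is a semigroup functor. -/
noncomputable def yonedaSemigroupFunctorStructure :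
    SemigroupFunctorStructure (yonedaEmbedding k S) where
  μ H K := yonedaTensorIso k H K
  μ_natural_left {H H'} f K :=
    show dayWhiskerRight _ ((yonedaEmbedding k S).map f) ≫ yonedaTensorHom k H' K =
      yonedaTensorHom k H K ≫ (yonedaEmbedding k S).map (f ▷ₛ K) from
    day_yoneda_hom_ext fun A B a b => by
      rw [LinearPresheaf.comp_comp, LinearPresheaf.comp_comp, dayWhiskerRight_pure,
        yoneda_map_component, yonedaTensorHom_pure, yonedaTensorHom_pure, yoneda_map_component,
        SemigroupCategory.comp_whiskerRight, Category.assoc, Category.assoc,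
        SemigroupCategory.whisker_exchange]
  μ_natural_right H {K K'} f :=
    show dayWhiskerLeft _ ((yonedaEmbedding k S).map f) ≫ yonedaTensorHom k H K' =
      yonedaTensorHom k H K ≫ (yonedaEmbedding k S).map (H ◁ₛ f) from
    day_yoneda_hom_ext fun A B a b => by
      rw [LinearPresheaf.comp_comp, LinearPresheaf.comp_comp, dayWhiskerLeft_pure,
        yoneda_map_component, yonedaTensorHom_pure, yonedaTensorHom_pure, yoneda_map_component,
        SemigroupCategory.whiskerLeft_comp, Category.assoc]
  associativity X Y Z :=
    show dayWhiskerRight _ (yonedaTensorHom k X Y) ≫ yonedaTensorHom k (X ⊠ Y) Z ≫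
        (yonedaEmbedding k S).map (αₛ X Y Z).hom =
      dayAssocHom _ _ _ ≫ dayWhiskerLeft _ (yonedaTensorHom k Y Z) ≫
        yonedaTensorHom k X (Y ⊠ Z) from
    day_hom_ext_left fun A B C a b c => by
      -- Presents the three elements as honest morphisms, so that the formulas for pure tensors of
      -- morphisms can rewrite.
      rw [← toYoneda_ofYoneda a, ← toYoneda_ofYoneda b, ← toYoneda_ofYoneda c]
      generalize ofYoneda a = a, ofYoneda b = b, ofYoneda c = c
      simp only [LinearPresheaf.comp_comp]
      rw [dayWhiskerRight_pure, dayAssocHom_pure, LinearPresheaf.comp_res, LinearPresheaf.comp_res,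
        dayWhiskerLeft_pure, yonedaTensorHom_pure, yonedaTensorHom_pure, yonedaTensorHom_pure,
        yonedaTensorHom_pure, yoneda_map_component, yoneda_res]
      simp only [SemigroupCategory.comp_whiskerRight, SemigroupCategory.whiskerLeft_comp,
        Category.assoc]
      -- What remains is naturality of the associator of `S` in `c`, `b` and `a`, in this order.
      rw [SemigroupCategory.associator_naturality_right,
        ← Category.assoc ((X ◁ₛ b) ▷ₛ C), SemigroupCategory.associator_naturality_middle,
        Category.assoc, ← Category.assoc ((a ▷ₛ B) ▷ₛ C),
        SemigroupCategory.associator_naturality_left, Category.assoc]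

lemma yonedaSemigroupFunctorStructure_μ_mk {H K X A B : S} (f : X ⟶ A ⊠ B) (a : A ⟶ H)
    (b : B ⟶ K) :
    (LinearPresheaf.component ((yonedaSemigroupFunctorStructure k S).μ H K).hom X
      (dayMk ((yonedaEmbedding k S).obj H) ((yonedaEmbedding k S).obj K) f a b) : X ⟶ H ⊠ K) =
        f ≫ a ▷ₛ B ≫ H ◁ₛ b := by
  change ofYoneda (LinearPresheaf.component (yonedaTensorHom k H K) X
    (dayMk _ _ f (toYoneda a) (toYoneda b))) = _
  rw [← dayRes_pure, LinearPresheaf.comp_res, yonedaTensorHom_pure, ofYoneda_res,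
    ofYoneda_toYoneda]

variable {k}

/-! ### Duals of representable presheaves -/

variable {F F' : S} (A : SemigroupAdjunction k F F')

/-- The evaluation `S(-, F) ⊛ S(-, F') ⟶ I`. -/
noncomputable def dayEvaluation :
    dayConvolution ((yonedaEmbedding k S).obj F) ((yonedaEmbedding k S).obj F') ⟶
      unitPresheaf k S :=
  -- By the Yoneda lemma a map from `S(-, F ⊠ F')` to the unit presheaf is an element of the latter
  -- at `F ⊠ F'`; the right counit is one.
  yonedaTensorHom k F F' ≫ yonedaLift A.counit

/-- The coevaluation `I ⟶ S(-, F') ⊛ S(-, F)`. -/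
noncomputable def dayCoevaluation :
    unitPresheaf k S ⟶
      dayConvolution ((yonedaEmbedding k S).obj F') ((yonedaEmbedding k S).obj F) :=
  LinearPresheaf.mkHom (P := unitPresheaf k S) (Q := (yonedaEmbedding k S).obj (F' ⊠ F))
    (fun E =>
      -- The left unit creates `F' ⊠ F` to the right of `E`, and `u` then absorbs `E`.
      { toFun := fun u => toYoneda (A.unitL E ≫ unitApp u (F' ⊠ F))
        map_add' := fun u u' => by
          rw [unitApp_add, Preadditive.comp_add, toYoneda_add]
        map_smul' := fun r u => by
          rw [unitApp_smul, Linear.comp_smul]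
          rfl })
    (fun {E E'} f u => by
      change toYoneda (A.unitL E ≫ unitApp _ (F' ⊠ F)) =
        toYoneda (f ≫ A.unitL E' ≫ unitApp u (F' ⊠ F))
      rw [unitApp_res, ← Category.assoc, ← A.unitL_naturality, Category.assoc]) ≫
  yonedaLift (yonedaPure k F' F)

lemma dayEvaluation_pure {X Y : S} (a : X ⟶ F) (b : Y ⟶ F') :
    LinearPresheaf.component (dayEvaluation A) (X ⊠ Y)
      (dayPure (toYoneda a) (toYoneda b)) =
        (unitPresheaf k S).res (a ▷ₛ Y ≫ F ◁ₛ b) A.counit := by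
  unfold dayEvaluation
  rw [LinearPresheaf.comp_comp, yonedaTensorHom_pure, yonedaLift_component]

lemma dayCoevaluation_component {E : S} (u : (unitPresheaf k S).value E) :
    LinearPresheaf.component (dayCoevaluation A) E u =
      (dayConvolution ((yonedaEmbedding k S).obj F') ((yonedaEmbedding k S).obj F)).res
        (A.unitL E ≫ unitApp u (F' ⊠ F)) (yonedaPure k F' F) := rfl

variable (hS : IsRigidSemigroupCategory k S)

/-- On `a ⊗ u`, once `a` is pulled to the front, `u` acts through `leftApp u F ▷ (F' ⊠ F)`.
Naturality of the left unit moves it out in front, and the first equation of condition 3 removes the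
unit and counit. -/
lemma dayCoevaluation_dayEvaluation :
    dayWhiskerLeft _ (dayCoevaluation A) ≫ dayAssocInv _ _ _ ≫
        dayWhiskerRight _ (dayEvaluation A) ≫
          (dayLeftUnitor ((yonedaEmbedding k S).obj F) hS).hom =
      (dayRightUnitor ((yonedaEmbedding k S).obj F) hS).hom :=
  day_hom_ext fun H E a u => by
    rw [← toYoneda_ofYoneda a]
    generalize ofYoneda a = a
    simp only [LinearPresheaf.comp_comp]
    rw [dayWhiskerLeft_pure, dayCoevaluation_component, dayPure_res_right, yonedaPure,
      LinearPresheaf.comp_res, dayAssocInv_pure, LinearPresheaf.comp_res, LinearPresheaf.comp_res,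
      LinearPresheaf.comp_res, LinearPresheaf.comp_res, dayWhiskerRight_pure, dayEvaluation_pure,
      dayLeftUnitor_pure, dayRightUnitor_pure, unitApp_res]
    simp only [yoneda_res, SemigroupCategory.whiskerLeft_id, Category.comp_id]
    have e : (αₛ H F' F).inv ≫ (a ▷ₛ F') ▷ₛ F ≫ unitApp A.counit F =
        a ▷ₛ (F' ⊠ F) ≫ (αₛ F F' F).inv ≫ unitApp A.counit F := by
      rw [← Category.assoc, associator_inv_naturality_left, Category.assoc]
    rw [e, ← Category.assoc (H ◁ₛ _), SemigroupCategory.whisker_exchange,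
      SemigroupCategory.whiskerLeft_comp, ← A.unitL_tensor, Category.assoc, Category.assoc,
      Category.assoc, ← Category.assoc (αₛ F E (F' ⊠ F)).hom, ← hS.leftApp_whiskerRight,
      ← Category.assoc (A.unitL _), ← A.unitL_naturality, Category.assoc, A.unitL_counit,
      Category.comp_id, hS.leftApp_naturality]

/-- Here condition 4 turns the left unit at `E`, whiskered by `F'`, into the right unit of `F'`, so
that `u` passes by naturality and the second equation of condition 3 applies. -/
lemma dayEvaluation_dayCoevaluation :
    dayWhiskerRight _ (dayCoevaluation A) ≫ dayAssocHom _ _ _ ≫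
        dayWhiskerLeft _ (dayEvaluation A) ≫
          (dayRightUnitor ((yonedaEmbedding k S).obj F') hS).hom =
      (dayLeftUnitor ((yonedaEmbedding k S).obj F') hS).hom :=
  day_hom_ext fun E H u a => by
    rw [← toYoneda_ofYoneda a]
    generalize ofYoneda a = a
    simp only [LinearPresheaf.comp_comp]
    rw [dayWhiskerRight_pure, dayCoevaluation_component, dayPure_res_left, yonedaPure,
      LinearPresheaf.comp_res, dayAssocHom_pure, LinearPresheaf.comp_res, LinearPresheaf.comp_res,
      LinearPresheaf.comp_res, LinearPresheaf.comp_res, dayWhiskerLeft_pure, dayEvaluation_pure,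
      dayRightUnitor_pure, dayLeftUnitor_pure, hS.leftApp_res, hS.leftApp_counit]
    simp only [yoneda_res, SemigroupCategory.id_whiskerRight, Category.id_comp, Category.comp_id]
    have e : (αₛ F' F H).hom ≫ F' ◁ₛ (F ◁ₛ a) ≫ A.counitL F' =
        (F' ⊠ F) ◁ₛ a ≫ (αₛ F' F F').hom ≫ A.counitL F' := by
      rw [← Category.assoc, ← SemigroupCategory.associator_naturality_right, Category.assoc]
    have e' : (A.unitL E ≫ unitApp u (F' ⊠ F)) ▷ₛ F' = unitApp u F' ≫ A.unitR F' := by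
      rw [SemigroupCategory.comp_whiskerRight, A.unitL_whiskerRight, Category.assoc,
        unitApp_tensor, unitApp_naturality]
    rw [e, ← Category.assoc, ← SemigroupCategory.whisker_exchange, e', Category.assoc,
      Category.assoc, A.unitR_counitL, Category.comp_id, unitApp_naturality]

/-- The representable presheaves of two dual objects are dual. -/
@[reducible]
noncomputable def dayExactPairing :
    letI : MonoidalCategory (LinearPresheaf k S) := (dayUnitStructure hS).toMonoidalCategory
    ExactPairing ((yonedaEmbedding k S).obj F') ((yonedaEmbedding k S).obj F) :=
  letI : MonoidalCategory (LinearPresheaf k S) := (dayUnitStructure hS).toMonoidalCategory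
  { coevaluation' := dayCoevaluation A
    evaluation' := dayEvaluation A
    coevaluation_evaluation' := by
      have h := dayCoevaluation_dayEvaluation A hS
      simp only [← Category.assoc] at h
      -- `ExactPairing` ends this zigzag with the inverse of the left unitor; it is moved to the
      -- other side to meet `h`.
      refine ((Iso.eq_comp_inv _).2 ?_)
      simp only [Category.assoc] at h ⊢
      exact h
    evaluation_coevaluation' := by
      have h := dayEvaluation_dayCoevaluation A hS
      refine ((Iso.eq_comp_inv _).2 ?_)
      simp only [Category.assoc]
      exact h }

lemma isRigidObject_yonedaEmbedding (F : S) :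
    (dayUnitStructure hS).IsRigidObject ((yonedaEmbedding k S).obj F) :=
  letI : MonoidalCategory (LinearPresheaf k S) := (dayUnitStructure hS).toMonoidalCategory
  -- The handedness is opposite to that in `S`: in `ExactPairing X Y` the evaluation starts at `Y ⊗
  -- X`, so a right dual in the sense of `SemigroupAdjunction` gives a `HasLeftDual`.
  ⟨⟨{ leftDual := (yonedaEmbedding k S).obj (hS.rightDual F)
      exact := dayExactPairing (hS.rightAdjunction F) hS }⟩,
    ⟨{ rightDual := (yonedaEmbedding k S).obj (hS.leftDual F)
       exact := dayExactPairing (hS.leftAdjunction F) hS }⟩⟩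

end Yoneda
end NonunitalRigidity

theorem theorem2p16 {k : Type w} [Field k] {S : Type u} [SmallCategory S] [Preadditive S]
    [Linear k S] [NonunitalRigidity.SemigroupCategory S]
    [NonunitalRigidity.LinearSemigroupCategory k S]
    (hS : NonunitalRigidity.IsRigidSemigroupCategory k S) :
    (∃ t : NonunitalRigidity.UnitStructure (NonunitalRigidity.unitPresheaf k S),
      ∀ F : S, t.IsRigidObject ((NonunitalRigidity.yonedaEmbedding k S).obj F)) ∧
    (NonunitalRigidity.yonedaEmbedding k S).Full ∧
    (NonunitalRigidity.yonedaEmbedding k S).Faithful ∧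
    ∃ y : NonunitalRigidity.SemigroupFunctorStructure (NonunitalRigidity.yonedaEmbedding k S),
      ∀ (H K X A B : S) (f : X ⟶ A ⊠ B) (a : A ⟶ H) (b : B ⟶ K),
        (NonunitalRigidity.LinearPresheaf.component (y.μ H K).hom X
          (NonunitalRigidity.dayMk ((NonunitalRigidity.yonedaEmbedding k S).obj H)
            ((NonunitalRigidity.yonedaEmbedding k S).obj K) f a b) : X ⟶ H ⊠ K) =
          f ≫ a ▷ₛ B ≫ H ◁ₛ b :=
  ⟨⟨NonunitalRigidity.dayUnitStructure hS,
      NonunitalRigidity.isRigidObject_yonedaEmbedding hS⟩,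
    NonunitalRigidity.yonedaEmbedding_full, NonunitalRigidity.yonedaEmbedding_faithful,
    NonunitalRigidity.yonedaSemigroupFunctorStructure k S, fun _ _ _ _ _ f a b =>
      NonunitalRigidity.yonedaSemigroupFunctorStructure_μ_mk k f a b⟩
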